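/- **Setting.** Let $V$ be a countably infinite set. A frog configuration is a pair $(n,s)$ with $n(x)\in\mathbb N_0$ ($x\in V$) and $s_j(x,i)\in V$ ($j\ge 0$, $x\in V$, $i\ge 1$), $s_0(x,i)=x$; the set of these is $\mathbb F$, with its product $\sigma$-field. For $v\in V$ let $W_0^v:=\{v\}$ and, for $j\ge1$, let $W_j^v$ be the set of $x\in V\setminus\bigcup_{k<j}W_k^v$ such that $s_{j-k}(y,i)=x$ for some $k<j$, $y\in W_k^v$, $1\le i\le n(y)$; let $W^v:=\bigcup_{j\ge0}W_j^v$. The site $v$ is *recurrent* for $(n,s)$ if there are infinitely many $x\in W^v$ for which there are $1\le i\le n(x)$ and $j\ge 0$ with $s_j(x,i)=v$. For a permutation $\varphi\in\mathrm{Sym}(V)$ let $\theta_\varphi(n,s):=\big((n(\varphi(x)))_x,(\varphi^{-1}(s_j(\varphi(x),i)))_{j,x,i}\big)$. A *general frog model* consists of random variables on a probability space $(\Omega,\mathcal F,P)$: $\eta(x)\in\mathbb N_0$ (number of initial frogs); $S_j(x,i)\in V$ for $j\ge0$, $x\in V$, $i\ge0$ with $S_0(x,i)=x$ (frog trajectories;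 $i=0$ is the extra frog at $x$); ellipticity variables $\kappa(x,y)\in[0,1]$; times $T(x,i)\in\mathbb N_0\cup\{\infty\}$, $i\ge1$; and choices $X_v\in V$, $v\in V$. Put $S:=(S_j(x,i))_{j\ge0,x\in V,i\ge1}$, $S^0:=(S_j(x,i))_{j\ge0,x\in V,i\ge0}$ and $\bar S_j(x,i):=S_{j\wedge T(x,i)}(x,i)$ for $i\ge1$. Let $R_v$ and $\bar R_v$ be the events that $v$ is recurrent for $(\eta,S)$ and for $(\eta,\bar S)$, respectively. The cluster $\mathcal C(v)$ is the set of those $y$ such that each of $v,y$ can be reached from the other along finite (possibly empty) sequences of steps $a\to b$ with $\kappa(a,b)>0$. For $i,j\ge 0$ let $\mathcal F_j(v,i)$ be the $\sigma$-field generated by $\kappa$, $T$, $\eta$, all $S_m(x,k)$ with $m\ge0$, $k\ge1$, $(x,k)\ne(v,i)$, and $S_m(v,i)$, $0\le m\le j$. **Assumptions.** - (EL) For all $v,y\in V$, $i\ge1$, $j\ge0$, $P$-a.s. $\kappa(S_j(v,i),y)\le P[S_{j+1}(v,i)=y\mid\mathcal F_j(v,i)]\le\mathbf 1_{\kappa(S_j(v,i),y)>0}$.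 - (UC) $P$-a.s. there is at most one infinite cluster. - (T) For all $v\in V$, $P[R_v]>0$ implies $P[\bar R_v]>0$. - (ERG) $P[A]\in\{0,1\}$ for every $A\in\mathcal F$ for which there is a measurable $B\subseteq\mathbb F$ such that $P[A\,\triangle\,\{\theta_\varphi(\eta,\bar S)\in B\}]=0$ for all $\varphi\in\mathrm{Sym}(V)$. - (EX) For all $v\in V$ the paths $(S_j(v,0))_{j\ge0}$ and $(S_j(v,1))_{j\ge0}$ are i.i.d. given $\mathcal F_0(v,1)$. - (Xv) For all $v\in V$, $X_v$ is independent of $(\kappa,T,\eta,S^0)$ and $P[X_v=v]>0$. - (ID) Let $o:V\to V$ satisfy $o\circ o=o$, let $\varphi_x\in\mathrm{Sym}(V)$ satisfy $\varphi_x(o(x))=x$ for each $x\in V$, and put $Z(x):=\big((\mathbf 1_{\bar R_{\varphi_x(y)}})_{y\in V},(\kappa(\varphi_x(y),\varphi_x(z)))_{y,z\in V},o(x)\big)$. For each $v\in V$ with $P[\#\mathcal C(X_v)=\infty]>0$ there is a probability measure $P_v$, mutually absolutely continuous with $P[\,\cdot\mid\#\mathcal C(X_v)=\infty]$, such that $Z(S_j(X_v,0))$,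 $j\ge0$, are identically distributed under $P_v$. **Theorem (zero-one law).** Assume (EL), (UC), (T), (ERG), (EX), (Xv), and (ID) for some such $o$ and $(\varphi_x)_{x\in V}$. Then either $P[R_v]=0$ for all $v\in V$, or $P[R_v]=P[\eta(v)\ge1,\ \#\mathcal C(v)=\infty]$ for all $v\in V$. -/

import Mathlib

open MeasureTheory ProbabilityTheory

/-- A frog configuration `(n, s)` on `V`: `n x` is the number of initial frogs at `x`, and
`s j x i` is the position after `j` steps of the `i`-th frog (`i ≥ 1`) originating at `x`.
It carries the trace of the product `σ`-field. -/
abbrev FrogConfig (V : Type*) : Type _ :=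
  {c : (V → ℕ) × (ℕ → V → ℕ+ → V) // ∀ x i, c.2 0 x i = x}

namespace FrogConfig

variable {V : Type*}

/-- The number of initial frogs at `x`. -/
def num (c : FrogConfig V) (x : V) : ℕ := c.1.1 x

/-- The position after `j` steps of the `i`-th frog originating at `x`. -/
def pos (c : FrogConfig V) (j : ℕ) (x : V) (i : ℕ+) : V := c.1.2 j x i

/-- `c.newSites v j` is the set of sites visited at time `j` for the first time by an active frog,
when at time `0` the frogs at `v` are woken up. -/
def newSites (c : FrogConfig V) (v : V) : ℕ → Set V
  | 0 => {v}
  | j + 1 => {x | (∀ k : Fin (j + 1), x ∉ newSites c v k) ∧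
      ∃ k : Fin (j + 1), ∃ y ∈ newSites c v k, ∃ i : ℕ+, (i : ℕ) ≤ c.num y ∧
        c.pos (j + 1 - k) y i = x}
  decreasing_by all_goals exact k.2

/-- The set of all sites ever visited by an active frog (including `v` itself). -/
def visited (c : FrogConfig V) (v : V) : Set V := ⋃ j, c.newSites v j

/-- The site `v` is recurrent: there are infinitely many distinct sites in `c.visited v`
from each of which an initial frog visits `v`. -/
def Recurrent (c : FrogConfig V) (v : V) : Prop :=
  {x | x ∈ c.visited v ∧ ∃ i : ℕ+, (i : ℕ) ≤ c.num x ∧ ∃ j, c.pos j x i = v}.Infinite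

/-- The action `θ_φ` of a permutation `φ` of `V` on frog configurations. -/
def perm (φ : Equiv.Perm V) (c : FrogConfig V) : FrogConfig V :=
  ⟨(fun x => c.num (φ x), fun j x i => φ.symm (c.pos j (φ x) i)), fun x i => by
    show φ.symm (c.1.2 0 (φ x) i) = x
    rw [c.2, Equiv.symm_apply_apply]⟩

end FrogConfig

/-- The random variables of a general frog model on `V`, defined on `Ω`. -/
structure FrogModel (V Ω : Type*) [MeasurableSpace V] [MeasurableSpace Ω] where
  /-- the ellipticity variables -/
  κ : V → V → Ω → Set.Icc (0 : ℝ) 1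
  /-- the (possibly infinite) time at which the `i`-th frog originating at `x` is stopped -/
  T : V → ℕ+ → Ω → ℕ∞
  /-- the choice of the extra frog used to examine the site `v` -/
  X : V → Ω → V
  /-- the number of initial frogs -/
  η : V → Ω → ℕ
  /-- `S j x i` is the position after `j` steps of the frog with index `i` originating at `x`;
  the index `0` is the extra frog, the indices `i ≥ 1` are the non-extra frogs -/
  S : ℕ → V → ℕ → Ω → V
  S_zero : ∀ x i ω, S 0 x i ω = x
  measurable_κ : ∀ x y, Measurable (κ x y)
  measurable_T : ∀ x i, Measurable (T x i)
  measurable_X : ∀ v, Measurable (X v)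
  measurable_η : ∀ x, Measurable (η x)
  measurable_S : ∀ j x i, Measurable (S j x i)

namespace FrogModel

variable {V Ω : Type*} [MeasurableSpace V] [MeasurableSpace Ω] (M : FrogModel V Ω)

/-- The random frog configuration `(η, S)` (without the extra frogs). -/
def config (ω : Ω) : FrogConfig V :=
  ⟨(fun x => M.η x ω, fun j x i => M.S j x i ω), fun x i => M.S_zero x i ω⟩

/-- The random configuration `(η, S̄)`, in which the frog trajectories are stopped at the
times `T`. -/
noncomputable def stoppedConfig (ω : Ω) : FrogConfig V :=
  ⟨(fun x => M.η x ω, fun j x i => M.S (min (j : ℕ∞) (M.T x i ω)).toNat x i ω),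
    fun x i => by simp [M.S_zero]⟩

/-- The event that `v` is recurrent for `(η, S)`. -/
def R (v : V) : Set Ω := {ω | (M.config ω).Recurrent v}

/-- The event that `v` is recurrent for `(η, S̄)`. -/
def Rbar (v : V) : Set Ω := {ω | (M.stoppedConfig ω).Recurrent v}

/-- `y` can be reached from `x` through finitely many (possibly no) steps with strictly positive
ellipticity variables. -/
def CanReach (ω : Ω) (x y : V) : Prop :=
  Relation.ReflTransGen (fun a b => (0 : ℝ) < M.κ a b ω) x y

/-- The cluster of `v`, i.e. its equivalence class with respect to `κ`. -/
def cluster (ω : Ω) (v : V) : Set V := {y | M.CanReach ω v y ∧ M.CanReach ω y v}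

/-- The `σ`-field `F_j(v, i)`: it is generated by `κ`, `T`, `η`, all non-extra frogs other than
`(v, i)`, and the first `j` steps of the frog `(v, i)`. -/
abbrev sigmaField (j : ℕ) (v : V) (i : ℕ) : MeasurableSpace Ω :=
  (⨆ (x : V) (y : V), MeasurableSpace.comap (M.κ x y) inferInstance) ⊔
  (⨆ (x : V) (k : ℕ+), MeasurableSpace.comap (M.T x k) inferInstance) ⊔
  (⨆ x : V, MeasurableSpace.comap (M.η x) inferInstance) ⊔
  (⨆ (m : ℕ) (x : V) (k : ℕ)
    (_ : (1 ≤ k ∧ (x, k) ≠ (v, i)) ∨ (m ≤ j ∧ (x, k) = (v, i))),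
    MeasurableSpace.comap (M.S m x k) inferInstance)

/-- Ellipticity. -/
def EL (P : Measure Ω) : Prop :=
  ∀ (v y : V) (i : ℕ), 1 ≤ i → ∀ j : ℕ, ∀ᵐ ω ∂P,
    (M.κ (M.S j v i ω) y ω : ℝ) ≤ (P⟦{ω' | M.S (j + 1) v i ω' = y} | M.sigmaField j v i⟧) ω ∧
    (P⟦{ω' | M.S (j + 1) v i ω' = y} | M.sigmaField j v i⟧) ω ≤
      if (0 : ℝ) < M.κ (M.S j v i ω) y ω then 1 else 0

/-- Uniqueness of the infinite cluster. -/
def UC (P : Measure Ω) : Prop :=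
  ∀ᵐ ω ∂P, ∀ x y, (M.cluster ω x).Infinite → (M.cluster ω y).Infinite →
    M.cluster ω x = M.cluster ω y

/-- If a site can be recurrent, then it can be recurrent for the stopped frogs. -/
def StopCond (P : Measure Ω) : Prop :=
  ∀ v, 0 < P (M.R v) → 0 < P (M.Rbar v)

/-- `A` is almost invariant with respect to the group of all permutations of `V`. -/
def AlmostInvariant (P : Measure Ω) (A : Set Ω) : Prop :=
  MeasurableSet A ∧ ∃ B : Set (FrogConfig V), MeasurableSet B ∧
    ∀ φ : Equiv.Perm V, A =ᵐ[P] {ω | (M.stoppedConfig ω).perm φ ∈ B}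

/-- Ergodicity. -/
def ERG (P : Measure Ω) : Prop :=
  ∀ A, M.AlmostInvariant P A → P A = 0 ∨ P A = 1

/-- The path of the frog with index `i` originating at `v`. -/
def path (v : V) (i : ℕ) (ω : Ω) : ℕ → V := fun j => M.S j v i ω

/-- The paths of the extra frog and of the first frog at `v` are i.i.d. given `F_0(v, 1)`:
they are conditionally independent and have the same conditional distribution. -/
def EX (P : Measure Ω) : Prop :=
  ∀ v : V,
    (∀ B C : Set (ℕ → V), MeasurableSet B → MeasurableSet C →
      P⟦M.path v 0 ⁻¹' B ∩ M.path v 1 ⁻¹' C | M.sigmaField 0 v 1⟧ =ᵐ[P]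
        P⟦M.path v 0 ⁻¹' B | M.sigmaField 0 v 1⟧ * P⟦M.path v 1 ⁻¹' C | M.sigmaField 0 v 1⟧) ∧
    (∀ B : Set (ℕ → V), MeasurableSet B →
      P⟦M.path v 0 ⁻¹' B | M.sigmaField 0 v 1⟧ =ᵐ[P] P⟦M.path v 1 ⁻¹' B | M.sigmaField 0 v 1⟧)

/-- `X_v` is independent of `(κ, T, η, S⁰)` and equals `v` with positive probability. -/
def XCond (P : Measure Ω) : Prop :=
  ∀ v : V,
    IndepFun (M.X v)
      (fun ω => ((fun x y => M.κ x y ω : V → V → Set.Icc (0 : ℝ) 1),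
        (fun x i => M.T x i ω : V → ℕ+ → ℕ∞), (fun x => M.η x ω : V → ℕ),
        (fun j x i => M.S j x i ω : ℕ → V → ℕ → V))) P ∧
    0 < P {ω | M.X v ω = v}

/-- The environment viewed from the vertex `x`, for a map `o` of representatives and
permutations `φ x` (used with `φ x (o x) = x`). -/
noncomputable def env (o : V → V) (φ : V → Equiv.Perm V) (x : V) (ω : Ω) :
    (V → ℕ) × (V → V → Set.Icc (0 : ℝ) 1) × V :=
  (fun y => (M.Rbar (φ x y)).indicator 1 ω, fun y z => M.κ (φ x y) (φ x z) ω, o x)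

/-- The event that the cluster of `X_v` is infinite. -/
def infCluster (v : V) : Set Ω := {ω | (M.cluster ω (M.X v ω)).Infinite}

/-- Under a measure equivalent to `P[ · | #C(X_v) = ∞]` the environment viewed from the extra frog
that starts at `X_v` is identically distributed in time. -/
def ID (o : V → V) (φ : V → Equiv.Perm V) (P : Measure Ω) : Prop :=
  ∀ v : V, 0 < P (M.infCluster v) →
    ∃ Pv : Measure Ω, IsProbabilityMeasure Pv ∧
      Pv ≪ P[|M.infCluster v] ∧ P[|M.infCluster v] ≪ Pv ∧
      ∀ j k : ℕ, IdentDistrib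
        (fun ω => M.env o φ (M.S j (M.X v ω) 0 ω) ω)
        (fun ω => M.env o φ (M.S k (M.X v ω) 0 ω) ω) Pv Pv

end FrogModel

/-! One inclusion is direct. Frogs a.s. take only steps with `κ > 0`, so the infinitely many sites
counted in the recurrence of v lie in the cluster of v; and v needs an initial frog of its own to
wake any other site. The substance is the converse: if some site is recurrent with positive
probability, then a.s. every occupied v in an infinite cluster is recurrent.

By (T) and (ERG) there is then a.s. a site that is recurrent for the stopped frogs. By (UC) it can
be reached from every infinite-cluster site in finitely many steps with weights bounded below. By
(ID) the environment seen from the extra frog has the same law at all times, up to an equivalent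
change of measure, so this frog is infinitely often uniformly close to recurrent sites
(`ae_oftenClose`). Lévy's zero-one law shows that an elliptic path which is infinitely often
uniformly close to a fixed set hits it (`IsEllipticPath.ae_hits`).

The extra frog is not part of the configuration, so it must be exchanged with a real one. Given
`F_0(v, 1)`, let q be the path of the first frog of v and p that of the extra frog; they are i.i.d.
Almost surely p hits a site x that is recurrent under q. If v wakes x under q, then v is recurrent
under q. Otherwise the recurrence of x uses no frog of v and survives replacing q by p
(`RelRecurrent.change_at`); under p the site v wakes x, so v is recurrent under p. Thus for almost
every pair v is recurrent under one of the two paths, and as they are i.i.d., under almost every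
path.

Passing from "v wakes a recurrent x" to "v is recurrent" rests on `EL.ae_infinite_visits`. The frogs
woken from x are examined one at a time. Given what has been seen, each is at most a constant factor
less likely to visit v than x, so conditional Borel–Cantelli carries infinitely many visits from x
over to v. -/

open Filter Topology Relation

/-! ### Recurrence in terms of the visiting relation between sites -/

/-- Recurrence of `v` for a relation `Q` on the sites, where `Q y x` means that some frog
originating at `y` visits `x`. -/
def RelRecurrent {V : Type*} (Q : V → V → Prop) (v : V) : Prop :=
  {x | ReflTransGen Q v x ∧ Q x v}.Infinite

theorem RelRecurrent.mono {V : Type*} {Q Q' : V → V → Prop} (h : ∀ x y, Q x y → Q' x y) {v : V}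
    (hQ : RelRecurrent Q v) : RelRecurrent Q' v :=
  Set.Infinite.mono (fun _ hx => ⟨ReflTransGen.mono h _ _ hx.1, h _ _ hx.2⟩) hQ

/-- If `Q` and `Q'` differ only in the frogs from `v`, and `x` is recurrent for `Q`, then
`x` is also recurrent for `Q'` or `x` is visited from `v` for `Q`. -/
theorem RelRecurrent.change_at {V : Type*} {Q Q' : V → V → Prop} {v x : V}
    (h : ∀ y ≠ v, ∀ z, Q y z → Q' y z) (hQ : RelRecurrent Q x) :
    ReflTransGen Q v x ∨ RelRecurrent Q' x := by
  by_cases hv : ReflTransGen Q v x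
  · exact Or.inl hv
  -- If v does not reach x, it reaches no z with `Q z x`, so no chain from x to such a z passes
  -- through v. None of the links used starts at v.
  refine Or.inr (Set.Infinite.mono ?_ hQ)
  rintro z ⟨hxz, hzx⟩
  have hvz : ¬ ReflTransGen Q v z := fun h' => hv (h'.tail hzx)
  have hzv : z ≠ v := by
    rintro rfl
    exact hvz .refl
  refine ⟨?_, h z hzv x hzx⟩
  clear hQ hv hzx
  induction hxz using ReflTransGen.head_induction_on with
  | refl => exact .refl
  | head hab hbz ih =>
    refine ReflTransGen.head (h _ ?_ _ hab) ih
    rintro rfl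
    exact hvz (hbz.head hab)

theorem RelRecurrent.map_equiv {V : Type*} {Q : V → V → Prop} (φ : V ≃ V) (v : V) :
    RelRecurrent (fun x y => Q (φ x) (φ y)) v ↔ RelRecurrent Q (φ v) := by
  have key : ∀ a b, ReflTransGen (fun x y => Q (φ x) (φ y)) a b ↔
      ReflTransGen Q (φ a) (φ b) := by
    intro a b
    refine ⟨fun h => h.lift φ fun _ _ h => h, fun h => ?_⟩
    have := h.lift (p := fun x y => Q (φ x) (φ y)) φ.symm
      (fun x y h => by simpa [Function.onFun] using h)
    simpa [Function.onFun] using this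
  unfold RelRecurrent
  have : {x | ReflTransGen Q (φ v) x ∧ Q x (φ v)} =
      φ '' {x | ReflTransGen (fun x y => Q (φ x) (φ y)) v x ∧ Q (φ x) (φ v)} := by
    ext x
    simp only [Set.mem_ofPred_eq, Set.mem_image, key]
    constructor
    · intro h
      exact ⟨φ.symm x, by simpa using h, by simp⟩
    · rintro ⟨y, h, rfl⟩
      exact h
  rw [this, Set.infinite_image_iff φ.injective.injOn]

namespace FrogConfig

variable {V : Type*}

/-- Some initial frog from `y` visits `x`. -/
def Visits (c : FrogConfig V) (y x : V) : Prop :=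
  ∃ i : ℕ+, (i : ℕ) ≤ c.num y ∧ ∃ j, c.pos j y i = x

theorem mem_newSites_succ {c : FrogConfig V} {v x : V} {j : ℕ} :
    x ∈ c.newSites v (j + 1) ↔ (∀ k ≤ j, x ∉ c.newSites v k) ∧
      ∃ k ≤ j, ∃ y ∈ c.newSites v k, ∃ i : ℕ+, (i : ℕ) ≤ c.num y ∧
        c.pos (j + 1 - k) y i = x := by
  rw [newSites]
  simp only [Set.mem_ofPred_eq, Fin.forall_iff, Fin.exists_iff, Nat.lt_succ_iff, exists_prop]

/-- Waking times affect only when a site is woken, not whether it is. This removes time from the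
notion of recurrence. -/
theorem mem_visited_iff (c : FrogConfig V) (v x : V) :
    x ∈ c.visited v ↔ ReflTransGen c.Visits v x := by
  constructor
  · intro h
    obtain ⟨j, hj⟩ := Set.mem_iUnion.1 h
    clear h
    induction j using Nat.strong_induction_on generalizing x with
    | _ j ih =>
      cases j with
      | zero =>
        rw [newSites] at hj
        rw [Set.mem_singleton_iff.1 hj]
      | succ j =>
        obtain ⟨-, k, hk, y, hy, i, hi, hx⟩ := mem_newSites_succ.1 hj
        exact (ih k (by omega) y hy).tail ⟨i, hi, _, hx⟩
  · intro h
    induction h with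
    | refl =>
      refine Set.mem_iUnion.2 ⟨0, ?_⟩
      rw [newSites]
      rfl
    | @tail y x _ hyx ih =>
      obtain ⟨k, hk⟩ := Set.mem_iUnion.1 ih
      obtain ⟨i, hi, m, hm⟩ := hyx
      cases m with
      | zero =>
        have : y = x := (c.2 y i).symm.trans hm
        exact this ▸ ih
      | succ m =>
        -- A frog woken at time k that reaches x after m + 1 steps arrives at time k + m + 1. Either
        -- x was woken earlier or it is new at exactly that time.
        by_cases hx : ∃ l ≤ k + m, x ∈ c.newSites v l
        · obtain ⟨l, -, hl⟩ := hx
          exact Set.mem_iUnion.2 ⟨l, hl⟩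
        · push Not at hx
          refine Set.mem_iUnion.2 ⟨k + m + 1, mem_newSites_succ.2
            ⟨hx, k, by omega, y, hk, i, hi, ?_⟩⟩
          rwa [show k + m + 1 - k = m + 1 by omega]

theorem recurrent_iff (c : FrogConfig V) (v : V) :
    c.Recurrent v ↔ RelRecurrent c.Visits v := by
  unfold Recurrent RelRecurrent
  simp only [mem_visited_iff]
  rfl

theorem visits_perm (φ : Equiv.Perm V) (c : FrogConfig V) (x y : V) :
    (c.perm φ).Visits x y ↔ c.Visits (φ x) (φ y) := by
  refine exists_congr fun i => and_congr Iff.rfl (exists_congr fun j => ?_)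
  exact Equiv.symm_apply_eq φ

theorem recurrent_perm (φ : Equiv.Perm V) (c : FrogConfig V) (v : V) :
    (c.perm φ).Recurrent v ↔ c.Recurrent (φ v) := by
  rw [recurrent_iff, recurrent_iff, ← RelRecurrent.map_equiv]
  have : (c.perm φ).Visits = fun x y => c.Visits (φ x) (φ y) := by
    funext x y
    exact propext (visits_perm φ c x y)
  rw [this]

end FrogConfig

/-! ### Measurability in a countable set of sites -/

section Measurability

variable {V α : Type*} [Countable V] [MeasurableSpace α]

theorem measurableSet_reflTransGen {Q : α → V → V → Prop}
    (hQ : ∀ x y, MeasurableSet {a | Q a x y}) (x y : V) :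
    MeasurableSet {a | ReflTransGen (Q a) x y} := by
  have key : ∀ n : ℕ, ∀ y, MeasurableSet {a | ∃ p : ℕ → V, p 0 = x ∧ p n = y ∧
      ∀ i < n, Q a (p i) (p (i + 1))} := by
    intro n
    induction n with
    | zero =>
      intro y
      by_cases h : x = y
      · convert MeasurableSet.univ using 1
        refine Set.eq_univ_of_forall fun a => ⟨fun _ => x, rfl, h, by simp⟩
      · convert MeasurableSet.empty using 1
        refine Set.eq_empty_of_forall_notMem fun a ⟨p, h0, h1, _⟩ => h (h0.symm.trans h1)
    | succ n ih =>
      intro y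
      have : {a | ∃ p : ℕ → V, p 0 = x ∧ p (n + 1) = y ∧ ∀ i < n + 1, Q a (p i) (p (i + 1))} =
          ⋃ z, {a | ∃ p : ℕ → V, p 0 = x ∧ p n = z ∧ ∀ i < n, Q a (p i) (p (i + 1))} ∩
            {a | Q a z y} := by
        ext a
        simp only [Set.mem_ofPred_eq, Set.mem_iUnion, Set.mem_inter_iff]
        constructor
        · rintro ⟨p, h0, h1, h⟩
          exact ⟨p n, ⟨p, h0, rfl, fun i hi => h i (by omega)⟩, h1 ▸ h n (by omega)⟩
        · rintro ⟨z, ⟨p, h0, h1, h⟩, hz⟩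
          refine ⟨fun i => if i ≤ n then p i else y, by simpa using h0, by simp, fun i hi => ?_⟩
          rcases Nat.lt_succ_iff_lt_or_eq.1 hi with hi | rfl
          · simpa [hi.le, Nat.succ_le_of_lt hi] using h i hi
          · simpa [h1] using hz
      rw [this]
      exact MeasurableSet.iUnion fun z => (ih z).inter (hQ z y)
  have : {a | ReflTransGen (Q a) x y} = ⋃ n : ℕ, {a | ∃ p : ℕ → V, p 0 = x ∧ p n = y ∧
      ∀ i < n, Q a (p i) (p (i + 1))} := by
    ext a
    simp only [Set.mem_ofPred_eq, Set.mem_iUnion]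
    constructor
    · intro h
      induction h with
      | refl => exact ⟨0, fun _ => x, rfl, rfl, by simp⟩
      | @tail z y _ hzy ih =>
        obtain ⟨n, p, h0, h1, h⟩ := ih
        refine ⟨n + 1, fun i => if i ≤ n then p i else y, by simpa using h0, by simp,
          fun i hi => ?_⟩
        rcases Nat.lt_succ_iff_lt_or_eq.1 hi with hi | rfl
        · simpa [hi.le, Nat.succ_le_of_lt hi] using h i hi
        · simpa [h1] using hzy
    · rintro ⟨n, p, rfl, rfl, h⟩
      have : ∀ m ≤ n, ReflTransGen (Q a) (p 0) (p m) := by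
        intro m
        induction m with
        | zero => exact fun _ => .refl
        | succ m ih => exact fun hm => (ih (by omega)).tail (h m (by omega))
      exact this n le_rfl
  rw [this]
  exact MeasurableSet.iUnion fun n => key n y

theorem measurableSet_infinite {D : α → Set V} (hD : ∀ x, MeasurableSet {a | x ∈ D a}) :
    MeasurableSet {a | (D a).Infinite} := by
  have : {a | (D a).Infinite} = ⋂ F : Finset V, ⋃ x : {x : V // x ∉ F}, {a | (x : V) ∈ D a} := by
    ext a
    simp only [Set.mem_ofPred_eq, Set.mem_iInter, Set.mem_iUnion]
    constructor
    · intro h F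
      obtain ⟨x, hx, hF⟩ := h.exists_notMem_finset F
      exact ⟨⟨x, hF⟩, hx⟩
    · intro h hfin
      obtain ⟨⟨x, hx⟩, hxD⟩ := h hfin.toFinset
      exact hx (by simpa using hxD)
  rw [this]
  exact MeasurableSet.iInter fun F => MeasurableSet.iUnion fun x => hD x

theorem measurableSet_relRecurrent {Q : α → V → V → Prop}
    (hQ : ∀ x y, MeasurableSet {a | Q a x y}) (v : V) :
    MeasurableSet {a | RelRecurrent (Q a) v} :=
  measurableSet_infinite fun x => (measurableSet_reflTransGen hQ v x).inter (hQ x v)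

end Measurability

/-! ### Reaching a set in few steps of probability at least `δ` -/

/-- From `a` the set `D` can be reached in at most `k` steps with weights at least `δ`. -/
def ReachWithin {V : Type*} (c : V → V → ℝ) (D : Set V) (δ : ℝ) : ℕ → V → Prop
  | 0, a => a ∈ D
  | k + 1, a => a ∈ D ∨ ∃ y, δ ≤ c a y ∧ ReachWithin c D δ k y

theorem ReachWithin.mono {V : Type*} {c : V → V → ℝ} {D : Set V} {δ δ' : ℝ} (hδ : δ' ≤ δ)
    {k k' : ℕ} (hk : k ≤ k') {a : V} (h : ReachWithin c D δ k a) : ReachWithin c D δ' k' a := by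
  induction k' generalizing k a with
  | zero =>
    obtain rfl : k = 0 := by omega
    exact h
  | succ k' ih =>
    cases k with
    | zero => exact Or.inl h
    | succ k =>
      rcases h with h | ⟨y, hy, h⟩
      · exact Or.inl h
      · exact Or.inr ⟨y, hδ.trans hy, ih (by omega) h⟩

/-- A finite chain has a smallest positive weight. One integer m bounds both the length and the
inverse weight, so closeness increases with m and only countably many bounds have to be considered.
-/
theorem exists_reachWithin_of_reflTransGen {V : Type*} {c : V → V → ℝ} {D : Set V} {a b : V}
    (h : ReflTransGen (fun x y => 0 < c x y) a b) (hb : b ∈ D) :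
    ∃ m : ℕ, ReachWithin c D (1 / ((m : ℝ) + 1)) m a := by
  induction h using ReflTransGen.head_induction_on with
  | refl => exact ⟨0, hb⟩
  | @head x y hxy _ ih =>
    obtain ⟨m, hm⟩ := ih
    obtain ⟨n, hn⟩ := exists_nat_one_div_lt hxy
    refine ⟨max m n + 1, Or.inr ⟨y, ?_, hm.mono ?_ (le_max_left _ _)⟩⟩
    · refine le_trans ?_ hn.le
      apply one_div_le_one_div_of_le (by positivity)
      have : (n : ℝ) ≤ (max m n : ℕ) := by exact_mod_cast le_max_right m n
      push_cast at this ⊢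
      linarith
    · apply one_div_le_one_div_of_le (by positivity)
      have : (m : ℝ) ≤ (max m n : ℕ) := by exact_mod_cast le_max_left m n
      push_cast at this ⊢
      linarith

/-- Allows closeness to the recurrent sites to be read off the relabelled environment that (ID)
controls. -/
theorem ReachWithin.map_equiv {V : Type*} {c : V → V → ℝ} {D : Set V} {δ : ℝ} (φ : V ≃ V)
    (k : ℕ) (a : V) :
    ReachWithin (fun x y => c (φ x) (φ y)) (φ ⁻¹' D) δ k a ↔ ReachWithin c D δ k (φ a) := by
  induction k generalizing a with
  | zero => rfl
  | succ k ih =>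
    refine or_congr Iff.rfl ?_
    simp only [ih]
    exact φ.exists_congr_right (q := fun y => δ ≤ c (φ a) y ∧ ReachWithin c D δ k y)

theorem measurableSet_reachWithin {V α : Type*} [Countable V] [MeasurableSpace α]
    {c : α → V → V → ℝ} {D : α → Set V} (hc : ∀ x y, Measurable fun a => c a x y)
    (hD : ∀ x, MeasurableSet {a | x ∈ D a}) (δ : ℝ) (k : ℕ) (x : V) :
    MeasurableSet {a | ReachWithin (c a) (D a) δ k x} := by
  induction k generalizing x with
  | zero => exact hD x
  | succ k ih =>
    have : {a | ReachWithin (c a) (D a) δ (k + 1) x} = {a | x ∈ D a} ∪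
        ⋃ y, {a | δ ≤ c a x y} ∩ {a | ReachWithin (c a) (D a) δ k y} := by
      ext a
      simp [ReachWithin]
    rw [this]
    exact (hD x).union (MeasurableSet.iUnion fun y =>
      (measurableSet_le measurable_const (hc x y)).inter (ih y))

/-- Comparison of conditional probabilities from a comparison of probabilities. -/
theorem const_mul_condExp_indicator_le {Ω : Type*} {m mΩ : MeasurableSpace Ω} {P : Measure Ω}
    [IsFiniteMeasure P] (hm : m ≤ mΩ) {s t : Set Ω} (hs : MeasurableSet s) (ht : MeasurableSet t)
    {c : ℝ} (h : ∀ B, MeasurableSet[m] B → c * P.real (B ∩ s) ≤ P.real (B ∩ t)) :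
    ∀ᵐ ω ∂P, c * (P[s.indicator (1 : Ω → ℝ) | m]) ω ≤ (P[t.indicator (1 : Ω → ℝ) | m]) ω := by
  have hint : ∀ {u : Set Ω}, MeasurableSet u → Integrable (u.indicator (1 : Ω → ℝ)) P :=
    fun hu => (integrable_const (1 : ℝ)).indicator hu
  have hle : (fun ω => c * (P[s.indicator (1 : Ω → ℝ) | m]) ω) ≤ᵐ[P.trim hm]
      P[t.indicator (1 : Ω → ℝ) | m] := by
    refine ae_le_of_forall_setIntegral_le
      ((integrable_condExp.trim hm stronglyMeasurable_condExp).const_mul c)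
      (integrable_condExp.trim hm stronglyMeasurable_condExp) fun B hB _ => ?_
    rw [integral_const_mul, ← setIntegral_trim hm stronglyMeasurable_condExp hB,
      ← setIntegral_trim hm stronglyMeasurable_condExp hB, setIntegral_condExp hm (hint hs) hB,
      setIntegral_condExp hm (hint ht) hB, setIntegral_indicator hs, setIntegral_indicator ht]
    simpa using h B hB
  exact ae_of_ae_trim hm hle

/-! ### Random paths satisfying an ellipticity bound -/

section PathMeasure

variable {V : Type*}

/-- The set of paths agreeing with `a` up to time `j`. -/
def pathCylinder (a : ℕ → V) (j : ℕ) : Set (ℕ → V) := {p | ∀ i ≤ j, p i = a i}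

/-- The paths that visit `D`. -/
def pathHits (D : Set V) : Set (ℕ → V) := {p | ∃ m, p m ∈ D}

/-- Given any finite past, the next step of the path from `x` leads to `y` with probability at
least `c x y`. -/
def IsEllipticPath [MeasurableSpace V] (c : V → V → ℝ) (μ : Measure (ℕ → V)) : Prop :=
  ∀ (a : ℕ → V) (j : ℕ) (y : V),
    c (a j) y * μ.real (pathCylinder a j) ≤ μ.real (pathCylinder a j ∩ {p | p (j + 1) = y})

variable [MeasurableSpace V] {c : V → V → ℝ} {μ : Measure (ℕ → V)}

theorem measurableSet_pathHits [Countable V] [MeasurableSingletonClass V] (D : Set V) :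
    MeasurableSet (pathHits D) := by
  have : pathHits D = ⋃ m, (fun p : ℕ → V => p m) ⁻¹' D := by
    ext p
    simp [pathHits]
  rw [this]
  exact MeasurableSet.iUnion fun m => measurable_pi_apply m (Set.to_countable D).measurableSet

theorem measurableSet_pathCylinder [Countable V] [MeasurableSingletonClass V] (a : ℕ → V)
    (j : ℕ) : MeasurableSet (pathCylinder a j) := by
  have : pathCylinder a j = ⋂ i, ⋂ (_ : i ≤ j), (fun p : ℕ → V => p i) ⁻¹' {a i} := by
    ext p
    simp [pathCylinder]
  rw [this]
  exact MeasurableSet.iInter fun i => MeasurableSet.iInter fun _ =>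
    measurable_pi_apply i (measurableSet_singleton _)

/-- Follow one prescribed route to D: each step extends the cylinder by one vertex and costs a
factor δ. Arriving early only helps, as δ ≤ 1. -/
theorem IsEllipticPath.real_cylinder_inter_hits [IsFiniteMeasure μ] (h : IsEllipticPath c μ)
    {D : Set V} {δ : ℝ} (h0 : 0 ≤ δ) (h1 : δ ≤ 1) {k : ℕ} {a : ℕ → V} {j : ℕ}
    (hr : ReachWithin c D δ k (a j)) :
    δ ^ k * μ.real (pathCylinder a j) ≤ μ.real (pathCylinder a j ∩ pathHits D) := by
  have base : ∀ k, a j ∈ D →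
      δ ^ k * μ.real (pathCylinder a j) ≤ μ.real (pathCylinder a j ∩ pathHits D) := by
    intro k hD
    have : pathCylinder a j ∩ pathHits D = pathCylinder a j :=
      Set.inter_eq_left.2 fun p hp => ⟨j, by rwa [hp j le_rfl]⟩
    rw [this]
    exact mul_le_of_le_one_left measureReal_nonneg (pow_le_one₀ h0 h1)
  induction k generalizing a j with
  | zero => exact base 0 hr
  | succ k ih =>
    rcases hr with hD | ⟨y, hy, hr⟩
    · exact base _ hD
    · have hcyl : pathCylinder a j ∩ {p | p (j + 1) = y} =
          pathCylinder (Function.update a (j + 1) y) (j + 1) := by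
        ext p
        simp only [pathCylinder, Set.mem_inter_iff, Set.mem_ofPred_eq]
        constructor
        · rintro ⟨hp, hpy⟩ i hi
          rcases Nat.le_succ_iff.1 hi with hi | rfl
          · rw [Function.update_of_ne (by omega), hp i hi]
          · simpa using hpy
        · intro hp
          refine ⟨fun i hi => ?_, by simpa using hp (j + 1) le_rfl⟩
          have := hp i (by omega)
          rwa [Function.update_of_ne (by omega)] at this
      have ih' := ih (a := Function.update a (j + 1) y) (j := j + 1) (by simpa using hr) (by
        intro k hD
        have : pathCylinder (Function.update a (j + 1) y) (j + 1) ∩ pathHits D =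
            pathCylinder (Function.update a (j + 1) y) (j + 1) :=
          Set.inter_eq_left.2 fun p hp => ⟨j + 1, by rwa [hp (j + 1) le_rfl]⟩
        rw [this]
        exact mul_le_of_le_one_left measureReal_nonneg (pow_le_one₀ h0 h1))
      rw [← hcyl] at ih'
      calc δ ^ (k + 1) * μ.real (pathCylinder a j)
          = δ ^ k * (δ * μ.real (pathCylinder a j)) := by ring
        _ ≤ δ ^ k * μ.real (pathCylinder a j ∩ {p | p (j + 1) = y}) := by
            gcongr
            exact (mul_le_mul_of_nonneg_right hy measureReal_nonneg).trans (h a j y)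
        _ ≤ _ := ih'
        _ ≤ _ := measureReal_mono
            (Set.inter_subset_inter_left _ Set.inter_subset_left)

/-- If `A` depends on the path up to time `j` only and `D` is always close at time `j` on `A`, then
`D` is visited with a probability bounded below, given `A`. -/
theorem IsEllipticPath.measure_inter_hits [Countable V] [MeasurableSingletonClass V]
    [IsFiniteMeasure μ] (h : IsEllipticPath c μ)
    {D : Set V} {δ : ℝ} (h0 : 0 ≤ δ) (h1 : δ ≤ 1) {k j : ℕ} {A : Set (ℕ → V)}
    (hA : ∀ p p' : ℕ → V, (∀ i ≤ j, p i = p' i) → p ∈ A → p' ∈ A)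
    (hr : ∀ p ∈ A, ReachWithin c D δ k (p j)) :
    ENNReal.ofReal (δ ^ k) * μ A ≤ μ (A ∩ pathHits D) := by
  let f : (ℕ → V) → (Fin (j + 1) → V) := fun p i => p i
  have hf : Measurable f := measurable_pi_lambda _ fun i => measurable_pi_apply _
  have hfib : ∀ b, MeasurableSet (f ⁻¹' {b}) := fun b => hf (measurableSet_singleton b)
  -- There are countably many possible pasts up to time j. Each fibre is a cylinder that A contains
  -- or misses, so the cylinder bound can be summed.
  have hdec : ∀ B : Set (ℕ → V), μ B = ∑' b, μ (B ∩ f ⁻¹' {b}) := by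
    intro B
    have := tsum_measure_preimage_singleton (μ := μ.restrict B) (Set.countable_univ) (f := f)
      (fun b _ => hfib b)
    rw [Set.preimage_univ, Measure.restrict_apply_univ,
      tsum_univ (fun b => (μ.restrict B) (f ⁻¹' {b}))] at this
    rw [← this]
    exact tsum_congr fun b => by rw [Measure.restrict_apply (hfib b), Set.inter_comm]
  rw [hdec A, hdec (A ∩ pathHits D), ← ENNReal.tsum_mul_left]
  refine ENNReal.tsum_le_tsum fun b => ?_
  rcases (A ∩ f ⁻¹' {b}).eq_empty_or_nonempty with he | ⟨a, haA, hab⟩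
  · rw [he]
    simp
  · have hcyl : f ⁻¹' {b} = pathCylinder a j := by
      ext p
      rw [Set.mem_preimage, Set.mem_singleton_iff, ← Set.mem_singleton_iff.1 hab, funext_iff]
      simp only [f, Fin.forall_iff, Nat.lt_succ_iff]
      rfl
    have hsub : A ∩ f ⁻¹' {b} = pathCylinder a j := by
      rw [hcyl]
      exact Set.inter_eq_right.2 fun p hp => hA a p (fun i hi => (hp i hi).symm) haA
    rw [Set.inter_right_comm, hsub, ← ofReal_measureReal, ← ofReal_measureReal,
      ← ENNReal.ofReal_mul (pow_nonneg h0 k)]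
    exact ENNReal.ofReal_le_ofReal (h.real_cylinder_inter_hits h0 h1 (hr a haA))

/-- If `v` is close to `x`, then visiting `v` is not much less likely than visiting `x`. -/
theorem IsEllipticPath.measure_hits_le [Countable V] [MeasurableSingletonClass V]
    [IsFiniteMeasure μ] (h : IsEllipticPath c μ)
    {δ : ℝ} (h0 : 0 ≤ δ) (h1 : δ ≤ 1) {k : ℕ} {x v : V} (hr : ReachWithin c {v} δ k x) :
    ENNReal.ofReal (δ ^ k) * μ (pathHits {x}) ≤ μ (pathHits {v}) := by
  -- Decompose by the first hitting time of x, an event determined by the path up to that time.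
  let A : ℕ → Set (ℕ → V) := fun n => {p | p n = x ∧ ∀ m < n, p m ≠ x}
  have hA : ∀ n, MeasurableSet (A n) := by
    intro n
    have : A n = (fun p : ℕ → V => p n) ⁻¹' {x} ∩
        ⋂ m, ⋂ (_ : m < n), (fun p : ℕ → V => p m) ⁻¹' {x}ᶜ := by
      ext p
      simp [A]
    rw [this]
    exact (measurable_pi_apply n (measurableSet_singleton x)).inter
      (MeasurableSet.iInter fun m => MeasurableSet.iInter fun _ =>
        measurable_pi_apply m (measurableSet_singleton x).compl)
  have hdisj : Pairwise (Function.onFun Disjoint A) := by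
    intro m n hmn
    refine Set.disjoint_left.2 fun p hm hn => ?_
    rcases lt_or_gt_of_ne hmn with h' | h'
    · exact hn.2 m h' hm.1
    · exact hm.2 n h' hn.1
  have hU : pathHits {x} = ⋃ n, A n := by
    classical
    ext p
    simp only [pathHits, Set.mem_singleton_iff, Set.mem_ofPred_eq, Set.mem_iUnion, A]
    exact ⟨fun hp => ⟨Nat.find hp, Nat.find_spec hp, fun m hm => Nat.find_min hp hm⟩,
      fun ⟨n, hn, _⟩ => ⟨n, hn⟩⟩
  calc ENNReal.ofReal (δ ^ k) * μ (pathHits {x})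
      = ∑' n, ENNReal.ofReal (δ ^ k) * μ (A n) := by
        rw [hU, measure_iUnion hdisj hA, ENNReal.tsum_mul_left]
    _ ≤ ∑' n, μ (A n ∩ pathHits {v}) := by
        refine ENNReal.tsum_le_tsum fun n => ?_
        refine h.measure_inter_hits h0 h1 (j := n) ?_ ?_
        · rintro p p' hp ⟨h1, h2⟩
          exact ⟨(hp n le_rfl).symm.trans h1, fun m hm => hp m hm.le ▸ h2 m hm⟩
        · rintro p ⟨hp, -⟩
          rwa [hp]
    _ = μ (⋃ n, A n ∩ pathHits {v}) := by
        rw [measure_iUnion]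
        · exact fun m n hmn => (hdisj hmn).mono Set.inter_subset_left Set.inter_subset_left
        · exact fun n => (hA n).inter (measurableSet_pathHits _)
    _ ≤ μ (pathHits {v}) := measure_mono (Set.iUnion_subset fun n => Set.inter_subset_right)

/-- A path that is infinitely often close to `D` visits `D`. -/
theorem IsEllipticPath.ae_hits [Countable V] [MeasurableSingletonClass V]
    [IsProbabilityMeasure μ] (h : IsEllipticPath c μ)
    {D : Set V} {δ : ℝ} (h0 : 0 < δ) (h1 : δ ≤ 1) (k : ℕ) :
    ∀ᵐ p ∂μ, (∃ᶠ j in atTop, ReachWithin c D δ k (p j)) → p ∈ pathHits D := by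
  let ℱ : Filtration ℕ (MeasurableSpace.pi (m := fun _ : ℕ => ‹MeasurableSpace V›)) :=
    Filtration.piLE
  have hmeas : MeasurableSet (pathHits D) := measurableSet_pathHits D
  let g : (ℕ → V) → ℝ := (pathHits D).indicator 1
  have hg : Integrable g μ := (integrable_const (1 : ℝ)).indicator hmeas
  have hcoord : ∀ m, ∀ s : Set V, MeasurableSet[ℱ m] ((fun p : ℕ → V => p m) ⁻¹' s) := by
    intro m s
    refine ⟨(fun q => q ⟨m, by simp⟩) ⁻¹' s,
      measurable_pi_apply _ (Set.to_countable s).measurableSet, rfl⟩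
  have hsup : MeasurableSet[⨆ n, ℱ n] (pathHits D) := by
    have : pathHits D = ⋃ m, (fun p : ℕ → V => p m) ⁻¹' D := by
      ext p
      simp [pathHits]
    rw [this]
    exact MeasurableSet.iUnion fun m => le_iSup (fun n => (ℱ n : MeasurableSpace (ℕ → V))) m _
      (hcoord m D)
  -- Lévy's upward theorem: the conditional probability of hitting D given the past converges to the
  -- indicator of hitting D. It is at least `δ ^ k` infinitely often, so the limit cannot be 0.
  have hlim := hg.tendsto_ae_condExp (ℱ := ℱ)
    (stronglyMeasurable_one.indicator hsup)
  have hlow : ∀ j, ∀ᵐ p ∂μ, ReachWithin c D δ k (p j) → δ ^ k ≤ (μ[g | ℱ j]) p := by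
    intro j
    let N : Set (ℕ → V) := {p | ReachWithin c D δ k (p j)}
    have hN : MeasurableSet[ℱ j] N := hcoord j {a | ReachWithin c D δ k a}
    have hN' : μ[N.indicator (1 : (ℕ → V) → ℝ) | ℱ j] = N.indicator 1 :=
      condExp_of_stronglyMeasurable (ℱ.le j) (stronglyMeasurable_one.indicator hN)
        ((integrable_const (1 : ℝ)).indicator (ℱ.le j _ hN))
    have hle : ∀ᵐ p ∂μ, δ ^ k * (μ[N.indicator (1 : (ℕ → V) → ℝ) | ℱ j]) p ≤ (μ[g | ℱ j]) p := by
      refine const_mul_condExp_indicator_le (ℱ.le j) (ℱ.le j _ hN) hmeas fun B hB => ?_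
      have := h.measure_inter_hits h0.le h1 (D := D) (k := k) (j := j) (A := B ∩ N) ?_
        fun p hp => hp.2
      · have := ENNReal.toReal_mono (measure_ne_top _ _) this
        rw [ENNReal.toReal_mul, ENNReal.toReal_ofReal (by positivity)] at this
        exact this.trans (measureReal_mono (Set.inter_subset_inter_left _ Set.inter_subset_left))
      · obtain ⟨t, -, ht⟩ := hB.inter hN
        intro p p' hpp' hp
        rw [← ht] at hp ⊢
        have : Preorder.restrictLe (π := fun _ => V) j p = Preorder.restrictLe j p' := by
          funext i
          exact hpp' i i.2
        rwa [Set.mem_preimage, ← this]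
    filter_upwards [hle] with p hp hpN
    rwa [hN', Set.indicator_of_mem (show p ∈ N from hpN), Pi.one_apply, mul_one] at hp
  filter_upwards [hlim, ae_all_iff.2 hlow] with p hp hlow hfreq
  by_contra hD
  have hgp : g p = 0 := Set.indicator_of_notMem hD _
  rw [hgp] at hp
  have hev := hp.eventually (gt_mem_nhds (show (0 : ℝ) < δ ^ k by positivity))
  obtain ⟨j, hj, hj'⟩ := (hfreq.and_eventually hev).exists
  exact absurd (hlow j hj) (not_le.2 hj')

end PathMeasure

/-! ### Regular conditional distributions given a `σ`-field -/

/-- The type `Ω` equipped with the `σ`-field `m`. -/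
def WithSigma (Ω : Type*) (_m : MeasurableSpace Ω) : Type _ := Ω

instance (Ω : Type*) (m : MeasurableSpace Ω) : MeasurableSpace (WithSigma Ω m) := m

/-- The identity map to `Ω` equipped with the `σ`-field `m`. -/
def toSigma {Ω : Type*} (m : MeasurableSpace Ω) : Ω → WithSigma Ω m := id

theorem measurable_toSigma {Ω : Type*} {m m0 : MeasurableSpace Ω} (h : m ≤ m0) :
    Measurable (toSigma m) := measurable_id'' h

theorem comap_toSigma {Ω : Type*} (m : MeasurableSpace Ω) :
    MeasurableSpace.comap (toSigma m) inferInstance = m := MeasurableSpace.comap_id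

section CondDistrib

variable {Ω E : Type*} {m mΩ : MeasurableSpace Ω} [MeasurableSpace E] [StandardBorelSpace E]
  [Nonempty E] {P : Measure Ω} [IsFiniteMeasure P]

/-- If `p` and `q` are i.i.d. given `m`, their joint conditional distribution is a product. -/
theorem map_prod_eq_compProd_of_condIID (hm : m ≤ mΩ) {p q : Ω → E} (hp : Measurable p)
    (hq : Measurable q)
    (hind : ∀ B C : Set E, MeasurableSet B → MeasurableSet C →
      P⟦p ⁻¹' B ∩ q ⁻¹' C | m⟧ =ᵐ[P] P⟦p ⁻¹' B | m⟧ * P⟦q ⁻¹' C | m⟧)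
    (hid : ∀ B : Set E, MeasurableSet B → P⟦p ⁻¹' B | m⟧ =ᵐ[P] P⟦q ⁻¹' B | m⟧) :
    P.map (fun ω => (toSigma m ω, q ω, p ω)) = P.map (toSigma m) ⊗ₘ
      (condDistrib q (toSigma m) P ×ₖ condDistrib q (toSigma m) P) := by
  have hX : Measurable (toSigma m) := measurable_toSigma hm
  refine Measure.ext_prod₃ fun {s t u} hs ht hu => ?_
  rw [Measure.map_apply (hX.prodMk (hq.prodMk hp)) (hs.prod (ht.prod hu)),
    Measure.compProd_apply_prod hs (ht.prod hu), setLIntegral_map hs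
      (Kernel.measurable_coe _ (ht.prod hu)) hX]
  have key : ∀ B : Set E, MeasurableSet B → ∀ᵐ ω ∂P,
      (condDistrib q (toSigma m) P (toSigma m ω)).real B = (P⟦q ⁻¹' B | m⟧) ω := by
    intro B hB
    have := condDistrib_ae_eq_condExp (μ := P) hX hq hB
    rwa [comap_toSigma] at this
  -- Conditional independence gives the product form; equality of the conditional laws lets the law
  -- of q stand in for that of p.
  have hprod : ∀ᵐ ω ∂P, (condDistrib q (toSigma m) P ×ₖ condDistrib q (toSigma m) P)
      (toSigma m ω) (t ×ˢ u) = ENNReal.ofReal ((P⟦p ⁻¹' u ∩ q ⁻¹' t | m⟧) ω) := by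
    filter_upwards [key t ht, key u hu, hind u t hu ht, hid u hu] with ω h1 h2 h3 h4
    rw [h3, Pi.mul_apply, h4, ← h1, ← h2, Kernel.prod_apply_prod, mul_comm,
      ENNReal.ofReal_mul measureReal_nonneg, ofReal_measureReal, ofReal_measureReal]
  rw [setLIntegral_congr_fun_ae (hX hs) (hprod.mono fun ω h _ => h)]
  have hs' : MeasurableSet[m] (toSigma m ⁻¹' s) := hs
  have hint : Integrable (Set.indicator (p ⁻¹' u ∩ q ⁻¹' t) fun _ => (1 : ℝ)) P :=
    (integrable_const _).indicator ((hp hu).inter (hq ht))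
  rw [← ofReal_integral_eq_lintegral_ofReal integrable_condExp.integrableOn,
    setIntegral_condExp hm hint hs', setIntegral_indicator ((hp hu).inter (hq ht)),
    setIntegral_const, smul_eq_mul, mul_one, ofReal_measureReal, Set.inter_comm (p ⁻¹' u)]
  · rfl
  · refine ae_restrict_of_ae (condExp_nonneg (Eventually.of_forall fun ω => ?_))
    exact Set.indicator_nonneg (fun _ _ => zero_le_one) ω

end CondDistrib

/-! ### The conditional law of one frog path given all other frogs -/

namespace FrogModel

variable {V Ω : Type*} [MeasurableSpace V] [mΩ : MeasurableSpace Ω] (M : FrogModel V Ω)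

theorem sigmaField_le (j : ℕ) (v : V) (i : ℕ) : M.sigmaField j v i ≤ mΩ := by
  refine sup_le (sup_le (sup_le ?_ ?_) ?_) ?_
  · exact iSup₂_le fun x y => (M.measurable_κ x y).comap_le
  · exact iSup₂_le fun x k => (M.measurable_T x k).comap_le
  · exact iSup_le fun x => (M.measurable_η x).comap_le
  · exact iSup₂_le fun m x => iSup₂_le fun k _ => (M.measurable_S m x k).comap_le

theorem sigmaField_mono {j j' : ℕ} (h : j ≤ j') (v : V) (i : ℕ) :
    M.sigmaField j v i ≤ M.sigmaField j' v i := by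
  refine sup_le_sup le_rfl ?_
  refine iSup₂_le fun m x => iSup₂_le fun k hk => ?_
  exact le_iSup₂_of_le m x (le_iSup₂_of_le k (hk.imp id fun h' => ⟨h'.1.trans h, h'.2⟩) le_rfl)

theorem measurable_κ_sigmaField (j : ℕ) (v : V) (i : ℕ) (x y : V) :
    Measurable[M.sigmaField j v i] (M.κ x y) :=
  Measurable.mono (comap_measurable _) (le_sup_of_le_left (le_sup_of_le_left (le_sup_of_le_left
    (le_iSup₂_of_le x y le_rfl)))) le_rfl

theorem measurable_T_sigmaField (j : ℕ) (v : V) (i : ℕ) (x : V) (k : ℕ+) :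
    Measurable[M.sigmaField j v i] (M.T x k) :=
  Measurable.mono (comap_measurable _) (le_sup_of_le_left (le_sup_of_le_left (le_sup_of_le_right
    (le_iSup₂_of_le x k le_rfl)))) le_rfl

theorem measurable_η_sigmaField (j : ℕ) (v : V) (i : ℕ) (x : V) :
    Measurable[M.sigmaField j v i] (M.η x) :=
  Measurable.mono (comap_measurable _) (le_sup_of_le_left (le_sup_of_le_right
    (le_iSup_of_le x le_rfl))) le_rfl

theorem measurable_S_sigmaField_of_ne (j : ℕ) {v : V} {i : ℕ} (m : ℕ) {x : V} {k : ℕ}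
    (hk : 1 ≤ k) (h : (x, k) ≠ (v, i)) : Measurable[M.sigmaField j v i] (M.S m x k) :=
  Measurable.mono (comap_measurable _) (le_sup_of_le_right
    (le_iSup₂_of_le m x (le_iSup₂_of_le k (Or.inl ⟨hk, h⟩) le_rfl))) le_rfl

theorem measurable_S_sigmaField_self {j m : ℕ} (hm : m ≤ j) (v : V) (i : ℕ) :
    Measurable[M.sigmaField j v i] (M.S m v i) :=
  Measurable.mono (comap_measurable _) (le_sup_of_le_right
    (le_iSup₂_of_le m v (le_iSup₂_of_le i (Or.inr ⟨hm, rfl⟩) le_rfl))) le_rfl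

theorem measurable_path (v : V) (i : ℕ) : Measurable (M.path v i) :=
  measurable_pi_lambda _ fun j => M.measurable_S j v i

variable [Countable V] [MeasurableSingletonClass V] [Nonempty V]

/-- The conditional distribution of the path of the `i`-th frog from `v` given the `σ`-field
`F_0(v, i)`. -/
noncomputable def pathLaw (P : Measure Ω) [IsFiniteMeasure P] (v : V) (i : ℕ) :
    Kernel (WithSigma Ω (M.sigmaField 0 v i)) (ℕ → V) :=
  condDistrib (M.path v i) (toSigma (M.sigmaField 0 v i)) P

instance (P : Measure Ω) [IsFiniteMeasure P] (v : V) (i : ℕ) :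
    IsMarkovKernel (M.pathLaw P v i) := by
  unfold pathLaw
  infer_instance

variable {M} {P : Measure Ω} [IsProbabilityMeasure P]

theorem pathLaw_ae_eq_condExp (v : V) (i : ℕ) {B : Set (ℕ → V)} (hB : MeasurableSet B) :
    ∀ᵐ ω ∂P, (M.pathLaw P v i (toSigma _ ω)).real B =
      (P⟦M.path v i ⁻¹' B | M.sigmaField 0 v i⟧) ω := by
  have := condDistrib_ae_eq_condExp (μ := P) (measurable_toSigma (M.sigmaField_le 0 v i))
    (M.measurable_path v i) hB
  rwa [comap_toSigma] at this

/-- (EL) conditions on `F_j`, to which a cylinder up to time j belongs. Since `κ` is already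
`F_0`-measurable, the tower property turns this into a bound on the conditional law given `F_0`. -/
theorem EL.ae_isEllipticPath (hEL : M.EL P) (v : V) {i : ℕ} (hi : 1 ≤ i) :
    ∀ᵐ ω ∂P, IsEllipticPath (fun x y => (M.κ x y ω : ℝ)) (M.pathLaw P v i (toSigma _ ω)) := by
  have key : ∀ (a : ℕ → V) (j : ℕ) (y : V), ∀ᵐ ω ∂P, (M.κ (a j) y ω : ℝ) *
      (M.pathLaw P v i (toSigma _ ω)).real (pathCylinder a j) ≤
      (M.pathLaw P v i (toSigma _ ω)).real (pathCylinder a j ∩ {p | p (j + 1) = y}) := by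
    intro a j y
    have hm0 := M.sigmaField_le 0 v i
    have hmj := M.sigmaField_le j v i
    have h0j := M.sigmaField_mono (Nat.zero_le j) v i
    have hC := measurableSet_pathCylinder a j
    have hnext : MeasurableSet {p : ℕ → V | p (j + 1) = y} :=
      measurable_pi_apply (X := fun _ : ℕ => V) (j + 1) (measurableSet_singleton y)
    set A : Set Ω := M.path v i ⁻¹' pathCylinder a j with hA
    set N : Set Ω := {ω' | M.S (j + 1) v i ω' = y} with hN
    have hNm : MeasurableSet N := M.measurable_S _ _ _ (measurableSet_singleton y)
    have hAm : MeasurableSet[M.sigmaField j v i] A := by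
      have : A = ⋂ l, ⋂ (_ : l ≤ j), M.S l v i ⁻¹' {a l} := by
        ext ω
        simp [hA, pathCylinder, path]
      rw [this]
      exact MeasurableSet.iInter fun l => MeasurableSet.iInter fun hl =>
        M.measurable_S_sigmaField_self hl v i (measurableSet_singleton _)
    have hintN : Integrable (N.indicator fun _ => (1 : ℝ)) P := (integrable_const _).indicator hNm
    have hintA : Integrable (A.indicator fun _ => (1 : ℝ)) P :=
      (integrable_const _).indicator (hmj _ hAm)
    have hκ0 : StronglyMeasurable[M.sigmaField 0 v i] fun ω => (M.κ (a j) y ω : ℝ) :=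
      (measurable_subtype_coe.comp (M.measurable_κ_sigmaField 0 v i (a j) y)).stronglyMeasurable
    have hintκA : Integrable ((fun ω => (M.κ (a j) y ω : ℝ)) * A.indicator fun _ => (1 : ℝ)) P := by
      refine hintA.bdd_mul (c := 1) (hκ0.mono hm0).aestronglyMeasurable
        (Eventually.of_forall fun ω => ?_)
      rw [Real.norm_eq_abs, abs_of_nonneg (M.κ (a j) y ω).2.1]
      exact (M.κ (a j) y ω).2.2
    have hcond : (fun ω => (M.κ (a j) y ω : ℝ)) * (A.indicator fun _ => (1 : ℝ)) ≤ᵐ[P]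
        P[(A ∩ N).indicator (fun _ => (1 : ℝ)) | M.sigmaField j v i] := by
      have h1 := condExp_indicator hintN hAm
      rw [Set.indicator_indicator] at h1
      filter_upwards [h1, hEL v y i hi j] with ω h1 h2
      rw [h1, Pi.mul_apply]
      by_cases hω : ω ∈ A
      · rw [Set.indicator_of_mem hω, Set.indicator_of_mem hω, mul_one]
        have : M.S j v i ω = a j := hω j le_rfl
        rw [this] at h2
        exact h2.1
      · rw [Set.indicator_of_notMem hω, Set.indicator_of_notMem hω, mul_zero]
    have hmono := condExp_mono (m := M.sigmaField 0 v i) hintκA integrable_condExp hcond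
    have htower := condExp_condExp_of_le (μ := P)
      (f := (A ∩ N).indicator (fun _ => (1 : ℝ))) h0j hmj
    have hpull := condExp_mul_of_stronglyMeasurable_left hκ0 hintκA hintA
    filter_upwards [hmono, htower, hpull, pathLaw_ae_eq_condExp (M := M) (P := P) v i hC,
      pathLaw_ae_eq_condExp (M := M) (P := P) v i (hC.inter hnext)] with ω h1 h2 h3 h4 h5
    rw [h4, h5]
    rw [h2, h3] at h1
    exact h1
  -- A cylinder depends only on the word up to time j, so a common null set needs just countably
  -- many words; the values after j are arbitrary.
  let ext : (j : ℕ) → (Fin (j + 1) → V) → ℕ → V := fun j b l =>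
    if h : l < j + 1 then b ⟨l, h⟩ else Classical.arbitrary V
  have hall : ∀ᵐ ω ∂P, ∀ (j : ℕ) (b : Fin (j + 1) → V) (y : V),
      (M.κ (ext j b j) y ω : ℝ) *
      (M.pathLaw P v i (toSigma _ ω)).real (pathCylinder (ext j b) j) ≤
      (M.pathLaw P v i (toSigma _ ω)).real (pathCylinder (ext j b) j ∩ {p | p (j + 1) = y}) := by
    simp only [ae_all_iff]
    exact fun j b y => key _ j y
  filter_upwards [hall] with ω hω a j y
  have := hω j (fun l => a l) y
  have hcyl : pathCylinder (ext j fun l => a l) j = pathCylinder a j := by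
    ext p
    refine forall₂_congr fun l hl => ?_
    simp [ext, hl]
  rw [hcyl] at this
  simpa [ext] using this

/-- A path starting from `v` that is close to `v'` on `A` reaches `v'` with a probability bounded
below. -/
theorem EL.measure_inter_hits_le (hEL : M.EL P) {v : V} {i : ℕ} (hi : 1 ≤ i) {x z : V} {δ : ℝ}
    (h0 : 0 ≤ δ) (h1 : δ ≤ 1) {k : ℕ} {A : Set Ω} (hA : MeasurableSet[M.sigmaField 0 v i] A)
    (hr : ∀ ω ∈ A, ReachWithin (fun a b => (M.κ a b ω : ℝ)) {z} δ k x) :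
    ENNReal.ofReal (δ ^ k) * P (A ∩ M.path v i ⁻¹' pathHits {x}) ≤
      P (A ∩ M.path v i ⁻¹' pathHits {z}) := by
  have hA' : MeasurableSet[MeasurableSpace.comap (toSigma (M.sigmaField 0 v i)) inferInstance] A :=
    by rwa [comap_toSigma]
  have hint : ∀ w, P (A ∩ M.path v i ⁻¹' pathHits {w}) =
      ∫⁻ ω in A, M.pathLaw P v i (toSigma _ ω) (pathHits {w}) ∂P := fun w =>
    (setLIntegral_condDistrib_of_measurableSet (measurable_toSigma (M.sigmaField_le 0 v i))
      (M.measurable_path v i).aemeasurable (measurableSet_pathHits {w}) hA').symm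
  rw [hint, hint, ← lintegral_const_mul']
  · refine setLIntegral_mono_ae' (M.sigmaField_le 0 v i _ hA) ?_
    filter_upwards [hEL.ae_isEllipticPath v hi] with ω hω hωA
    exact hω.measure_hits_le h0 h1 (hr ω hωA)
  · exact ENNReal.ofReal_ne_top

end FrogModel

/-! ### Exploring the woken frogs one at a time -/

/-- The sets whose trace on `C` is `F`-measurable. -/
@[reducible] def traceSigma {Ω : Type*} (F : MeasurableSpace Ω) {C : Set Ω}
    (hC : MeasurableSet[F] C) :
    MeasurableSpace Ω where
  MeasurableSet' B := MeasurableSet[F] (B ∩ C)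
  measurableSet_empty := by simp
  measurableSet_compl B hB := by
    have : Bᶜ ∩ C = C \ (B ∩ C) := by
      ext ω
      simp only [Set.mem_inter_iff, Set.mem_compl_iff, Set.mem_sdiff]
      tauto
    rw [this]
    exact hC.diff hB
  measurableSet_iUnion f hf := by
    rw [Set.iUnion_inter]
    exact MeasurableSet.iUnion hf

namespace FrogModel

variable {V Ω : Type*} [MeasurableSpace V] [mΩ : MeasurableSpace Ω] (M : FrogModel V Ω)

/-- The event that the frog `f` visits `z`. -/
def hitEvent (f : V × ℕ+) (z : V) : Set Ω := M.path f.1 f.2 ⁻¹' pathHits {z}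

/-- The events that a site is awake, respectively that a frog has been examined, after `n` steps of
the exploration of the set of sites visited from `x`. In the `n`-th step the frog `r n` is
examined if its site is awake and if it has not been examined before. -/
def explore (x : V) (r : ℕ → V × ℕ+) : ℕ → (V → Set Ω) × (V × ℕ+ → Set Ω)
  | 0 => (fun y => {_ω | y = x}, fun _ => ∅)
  | n + 1 =>
    (fun y => (explore x r n).1 y ∪ ((explore x r n).1 (r n).1 ∩
        {ω | ((r n).2 : ℕ) ≤ M.η (r n).1 ω} ∩ ((explore x r n).2 (r n))ᶜ ∩ M.hitEvent (r n) y),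
      fun f => (explore x r n).2 f ∪ ((explore x r n).1 (r n).1 ∩
        {ω | ((r n).2 : ℕ) ≤ M.η (r n).1 ω} ∩ ((explore x r n).2 (r n))ᶜ ∩ {_ω | f = r n}))

/-- `y` is awake after `n` steps of the exploration. -/
def awake (x : V) (r : ℕ → V × ℕ+) (n : ℕ) (y : V) : Set Ω := (M.explore x r n).1 y

/-- The frog `f` has been examined in the first `n` steps of the exploration. -/
def examined (x : V) (r : ℕ → V × ℕ+) (n : ℕ) (f : V × ℕ+) : Set Ω := (M.explore x r n).2 f

/-- The frog `r n` is examined in the `n`-th step of the exploration. -/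
def examines (x : V) (r : ℕ → V × ℕ+) (n : ℕ) : Set Ω :=
  M.awake x r n (r n).1 ∩ {ω | ((r n).2 : ℕ) ≤ M.η (r n).1 ω} ∩ (M.examined x r n (r n))ᶜ

variable {x : V} {r : ℕ → V × ℕ+}

theorem awake_zero (y : V) : M.awake x r 0 y = {_ω | y = x} := rfl

theorem examined_zero (f : V × ℕ+) : M.examined x r 0 f = ∅ := rfl

theorem awake_succ (n : ℕ) (y : V) :
    M.awake x r (n + 1) y = M.awake x r n y ∪ (M.examines x r n ∩ M.hitEvent (r n) y) := rfl

theorem examined_succ (n : ℕ) (f : V × ℕ+) :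
    M.examined x r (n + 1) f = M.examined x r n f ∪ (M.examines x r n ∩ {_ω | f = r n}) := rfl

variable (x r) in
/-- The information obtained in the first `n` steps of the exploration. -/
@[reducible] def exploreSigma : ℕ → MeasurableSpace Ω
  | 0 => (⨆ (x : V) (y : V), MeasurableSpace.comap (M.κ x y) inferInstance) ⊔
      (⨆ x : V, MeasurableSpace.comap (M.η x) inferInstance)
  | n + 1 => exploreSigma n ⊔ MeasurableSpace.generateFrom
      (Set.range fun z => M.examines x r n ∩ M.hitEvent (r n) z)

theorem exploreSigma_mono : Monotone (M.exploreSigma x r) :=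
  monotone_nat_of_le_succ fun _ => le_sup_left

theorem measurableSet_examines_inter_hitEvent (n : ℕ) (z : V) :
    MeasurableSet[M.exploreSigma x r (n + 1)] (M.examines x r n ∩ M.hitEvent (r n) z) :=
  le_sup_right (a := M.exploreSigma x r n) _
    (MeasurableSpace.measurableSet_generateFrom ⟨z, rfl⟩)

theorem hitEvent_self (f : V × ℕ+) : M.hitEvent f f.1 = Set.univ :=
  Set.eq_univ_of_forall fun _ => ⟨0, M.S_zero _ _ _⟩

theorem measurable_κ_exploreSigma (n : ℕ) (a b : V) :
    Measurable[M.exploreSigma x r n] (M.κ a b) :=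
  Measurable.mono (comap_measurable _) ((le_sup_of_le_left (le_iSup₂_of_le a b le_rfl)).trans
    (M.exploreSigma_mono (Nat.zero_le n))) le_rfl

theorem measurable_η_exploreSigma (n : ℕ) (a : V) :
    Measurable[M.exploreSigma x r n] (M.η a) :=
  Measurable.mono (comap_measurable _) ((le_sup_of_le_right (le_iSup_of_le a le_rfl)).trans
    (M.exploreSigma_mono (Nat.zero_le n))) le_rfl

theorem measurableSet_awake_examined (n : ℕ) :
    (∀ y, MeasurableSet[M.exploreSigma x r n] (M.awake x r n y)) ∧
      ∀ f, MeasurableSet[M.exploreSigma x r n] (M.examined x r n f) := by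
  induction n with
  | zero =>
    refine ⟨fun y => ?_, fun f => ?_⟩
    · rw [awake_zero]
      exact @MeasurableSet.const _ (M.exploreSigma x r 0) _
    · rw [examined_zero]
      exact @MeasurableSet.empty _ (M.exploreSigma x r 0)
  | succ n ih =>
    have hle := M.exploreSigma_mono (x := x) (r := r) (Nat.le_succ n)
    refine ⟨fun y => ?_, fun f => ?_⟩
    · rw [awake_succ]
      exact (hle _ (ih.1 y)).union (M.measurableSet_examines_inter_hitEvent n y)
    · rw [examined_succ]
      refine (hle _ (ih.2 f)).union (MeasurableSet.inter ?_ (MeasurableSet.const _))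
      -- Every frog visits its own starting site, so this choice of target recovers the bare event
      -- of examination.
      have := M.measurableSet_examines_inter_hitEvent (x := x) (r := r) n (r n).1
      rwa [hitEvent_self, Set.inter_univ] at this

theorem measurableSet_examines (n : ℕ) :
    MeasurableSet[M.exploreSigma x r n] (M.examines x r n) :=
  (((M.measurableSet_awake_examined n).1 _).inter
    (M.measurable_η_exploreSigma n _ measurableSet_Ici)).inter
    ((M.measurableSet_awake_examined n).2 _).compl

variable [MeasurableSingletonClass V]

theorem measurableSet_hitEvent [Countable V] (f : V × ℕ+) (z : V) :
    MeasurableSet (M.hitEvent f z) :=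
  M.measurable_path f.1 f.2 (measurableSet_pathHits {z})

theorem measurableSet_hitEvent_sigmaField {f g : V × ℕ+} (h : g ≠ f) (z : V) :
    MeasurableSet[M.sigmaField 0 f.1 f.2] (M.hitEvent g z) := by
  have : M.hitEvent g z = ⋃ m, M.S m g.1 g.2 ⁻¹' {z} := by
    ext ω
    simp [hitEvent, pathHits, path]
  rw [this]
  refine MeasurableSet.iUnion fun m => M.measurable_S_sigmaField_of_ne 0 m g.2.2 ?_
    (measurableSet_singleton z)
  intro he
  rw [Prod.mk.injEq] at he
  exact h (Prod.ext he.1 (PNat.eq he.2))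

theorem exploreSigma_le [Countable V] (n : ℕ) : M.exploreSigma x r n ≤ mΩ := by
  induction n with
  | zero =>
    exact sup_le (iSup₂_le fun x y => (M.measurable_κ x y).comap_le)
      (iSup_le fun x => (M.measurable_η x).comap_le)
  | succ n ih =>
    refine sup_le ih (MeasurableSpace.generateFrom_le ?_)
    rintro _ ⟨z, rfl⟩
    exact (ih _ (M.measurableSet_examines n)).inter (M.measurableSet_hitEvent _ z)

/-- As long as the frog `f` has not been examined, the exploration gives no information about it. -/
theorem measurableSet_exploreSigma_diff_examined (n : ℕ) (f : V × ℕ+) :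
    MeasurableSet[M.sigmaField 0 f.1 f.2] (M.examined x r n f)ᶜ ∧
    ∀ B, MeasurableSet[M.exploreSigma x r n] B →
      MeasurableSet[M.sigmaField 0 f.1 f.2] (B ∩ (M.examined x r n f)ᶜ) := by
  induction n with
  | zero =>
    rw [examined_zero, Set.compl_empty]
    refine ⟨MeasurableSet.univ, fun B hB => ?_⟩
    rw [Set.inter_univ]
    have hle : M.exploreSigma x r 0 ≤ M.sigmaField 0 f.1 f.2 :=
      sup_le (iSup₂_le fun x y => (M.measurable_κ_sigmaField 0 _ _ x y).comap_le)
        (iSup_le fun x => (M.measurable_η_sigmaField 0 _ _ x).comap_le)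
    exact hle _ hB
  | succ n ih =>
    have hsub : (M.examined x r (n + 1) f)ᶜ ⊆ (M.examined x r n f)ᶜ :=
      Set.compl_subset_compl.2 Set.subset_union_left
    have hC : MeasurableSet[M.sigmaField 0 f.1 f.2] (M.examined x r (n + 1) f)ᶜ := by
      rw [examined_succ]
      by_cases hf : f = r n
      · have : (M.examined x r n f ∪ (M.examines x r n ∩ {_ω | f = r n}))ᶜ =
            (M.examined x r n f)ᶜ \ (M.examines x r n ∩ (M.examined x r n f)ᶜ) := by
          ext ω
          simp only [Set.mem_compl_iff, Set.mem_union, Set.mem_inter_iff, Set.mem_sdiff,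
            Set.mem_ofPred_eq, hf]
          tauto
        rw [this]
        exact ih.1.diff (ih.2 _ (M.measurableSet_examines n))
      · simpa [hf] using ih.1
    refine ⟨hC, ?_⟩
    -- Sets with an `F_0`-measurable trace on the event that f is unexamined form a σ-field, so
    -- generators suffice.
    have hle : M.exploreSigma x r (n + 1) ≤ traceSigma _ hC := by
      refine sup_le (fun B hB => ?_) (MeasurableSpace.generateFrom_le ?_)
      · have : B ∩ (M.examined x r (n + 1) f)ᶜ =
            (B ∩ (M.examined x r n f)ᶜ) ∩ (M.examined x r (n + 1) f)ᶜ := by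
          rw [Set.inter_assoc, Set.inter_eq_right.2 hsub]
        change MeasurableSet[M.sigmaField 0 f.1 f.2] (B ∩ (M.examined x r (n + 1) f)ᶜ)
        rw [this]
        exact (ih.2 B hB).inter hC
      · rintro _ ⟨z, rfl⟩
        change MeasurableSet[M.sigmaField 0 f.1 f.2]
          (M.examines x r n ∩ M.hitEvent (r n) z ∩ (M.examined x r (n + 1) f)ᶜ)
        by_cases hf : f = r n
        -- A step that examines f itself leaves no trace on the event that f is still unexamined.
        · convert @MeasurableSet.empty _ (M.sigmaField 0 f.1 f.2)
          refine Set.eq_empty_of_forall_notMem fun ω hω => hω.2 ?_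
          rw [examined_succ]
          exact Or.inr ⟨hω.1.1, hf⟩
        · have : M.examines x r n ∩ M.hitEvent (r n) z ∩ (M.examined x r (n + 1) f)ᶜ =
              (M.examines x r n ∩ (M.examined x r n f)ᶜ) ∩ M.hitEvent (r n) z ∩
                (M.examined x r (n + 1) f)ᶜ := by
            ext ω
            have := @hsub ω
            simp only [Set.mem_inter_iff]
            tauto
          rw [this]
          exact ((ih.2 _ (M.measurableSet_examines n)).inter
            (M.measurableSet_hitEvent_sigmaField (Ne.symm hf) z)).inter hC
    exact fun B hB => hle B hB

end FrogModel

/-! ### Exhaustiveness of the exploration and conditional Borel–Cantelli -/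

namespace FrogModel

section Exploration

variable {V Ω : Type*} [MeasurableSpace V] [MeasurableSpace Ω] {M : FrogModel V Ω}
  {x : V} {r : ℕ → V × ℕ+} {ω : Ω}

theorem awake_mono {m n : ℕ} (h : m ≤ n) (y : V) : M.awake x r m y ⊆ M.awake x r n y :=
  monotone_nat_of_le_succ (f := fun n => M.awake x r n y) (fun _ => Set.subset_union_left) h

theorem examined_mono {m n : ℕ} (h : m ≤ n) (f : V × ℕ+) :
    M.examined x r m f ⊆ M.examined x r n f :=
  monotone_nat_of_le_succ (f := fun n => M.examined x r n f) (fun _ => Set.subset_union_left) h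

theorem visits_iff_hitEvent {y z : V} : (M.config ω).Visits y z ↔
    ∃ i : ℕ+, (i : ℕ) ≤ M.η y ω ∧ ω ∈ M.hitEvent (y, i) z := Iff.rfl

theorem reflTransGen_of_mem_awake {n : ℕ} {y : V} (h : ω ∈ M.awake x r n y) :
    ReflTransGen (M.config ω).Visits x y := by
  induction n generalizing y with
  | zero =>
    obtain rfl : y = x := h
    exact .refl
  | succ n ih =>
    rcases h with h | ⟨h, hy⟩
    · exact ih h
    · exact (ih h.1.1).tail (visits_iff_hitEvent.2 ⟨_, h.1.2, hy⟩)

theorem exists_examines_of_mem_examined {n : ℕ} {f : V × ℕ+} (h : ω ∈ M.examined x r n f) :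
    ∃ m < n, r m = f ∧ ω ∈ M.examines x r m := by
  induction n with
  | zero => exact absurd h (Set.notMem_empty _)
  | succ n ih =>
    rcases h with h | ⟨h, hf⟩
    · obtain ⟨m, hm, h⟩ := ih h
      exact ⟨m, by omega, h⟩
    · exact ⟨n, by omega, hf.symm, h⟩

/-- The schedule `r` offers the frog again after its site has woken. It is examined then, unless
this has happened before. -/
theorem exists_examines {n : ℕ} {y : V} (hr : ∀ f, ∃ᶠ n in atTop, r n = f)
    (h : ω ∈ M.awake x r n y) {i : ℕ+} (hi : (i : ℕ) ≤ M.η y ω) :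
    ∃ m, r m = (y, i) ∧ ω ∈ M.examines x r m := by
  obtain ⟨m, hm, hrm⟩ := frequently_atTop.1 (hr (y, i)) n
  by_cases he : ω ∈ M.examined x r m (y, i)
  · obtain ⟨l, -, hl⟩ := exists_examines_of_mem_examined he
    exact ⟨l, hl⟩
  · refine ⟨m, hrm, ⟨?_, ?_⟩, ?_⟩
    · rw [hrm]
      exact awake_mono hm y h
    · simpa [hrm] using hi
    · rwa [hrm]

theorem exists_mem_awake (hr : ∀ f, ∃ᶠ n in atTop, r n = f) {y : V}
    (h : ReflTransGen (M.config ω).Visits x y) : ∃ n, ω ∈ M.awake x r n y := by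
  induction h with
  | refl => exact ⟨0, rfl⟩
  | tail _ hyz ih =>
    obtain ⟨n, hn⟩ := ih
    obtain ⟨i, hi, hz⟩ := visits_iff_hitEvent.1 hyz
    obtain ⟨m, hrm, hm⟩ := exists_examines hr hn hi
    exact ⟨m + 1, Or.inr ⟨hm, hrm ▸ hz⟩⟩

theorem injOn_examines : Set.InjOn r {n | ω ∈ M.examines x r n} := by
  have key : ∀ m n, m < n → ω ∈ M.examines x r m → ω ∈ M.examines x r n → r m ≠ r n := by
    intro m n hmn hm hn h
    exact hn.2 (examined_mono (Nat.succ_le_of_lt hmn) _ (Or.inr ⟨hm, h.symm⟩))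
  intro m hm n hn h
  rcases lt_trichotomy m n with h' | h' | h'
  · exact absurd h (key m n h' hm hn)
  · exact h'
  · exact absurd h.symm (key n m h' hn hm)

/-- Infinitely many awakened sites have a frog visiting `z` if and only if infinitely often a frog
visiting `z` is examined. -/
theorem infinite_visits_iff (hr : ∀ f, ∃ᶠ n in atTop, r n = f) (z : V) :
    {y | ReflTransGen (M.config ω).Visits x y ∧ (M.config ω).Visits y z}.Infinite ↔
      {n | ω ∈ M.examines x r n ∩ M.hitEvent (r n) z}.Infinite := by
  constructor
  · intro h
    refine Set.Infinite.of_image (fun n => (r n).1) (h.mono ?_)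
    rintro y ⟨hxy, hyz⟩
    obtain ⟨n, hn⟩ := exists_mem_awake (r := r) hr hxy
    obtain ⟨i, hi, hz⟩ := visits_iff_hitEvent.1 hyz
    obtain ⟨m, hrm, hm⟩ := exists_examines hr hn hi
    exact ⟨m, ⟨hm, hrm ▸ hz⟩, by simp [hrm]⟩
  · intro h hfin
    -- A site has finitely many frogs and no frog is examined twice, so finitely many sites would
    -- leave only finitely many successful steps.
    refine h (Set.Finite.of_finite_image (f := r) ?_
      (injOn_examines (M := M) (x := x) (ω := ω) |>.mono fun n hn => hn.1))
    refine (hfin.biUnion (t := fun y => (fun i : ℕ+ => (y, i)) '' {i | (i : ℕ) ≤ M.η y ω})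
      fun y _ => ?_).subset ?_
    · refine Set.Finite.image _ (Set.Finite.of_finite_image (f := ((↑) : ℕ+ → ℕ))
        ((Set.finite_Iic (M.η y ω)).subset ?_) PNat.coe_injective.injOn)
      rintro _ ⟨i, hi, rfl⟩
      exact hi
    · rintro _ ⟨n, ⟨hn, hz⟩, rfl⟩
      exact Set.mem_biUnion (x := (r n).1) ⟨reflTransGen_of_mem_awake hn.1.1,
        visits_iff_hitEvent.2 ⟨_, hn.1.2, hz⟩⟩ ⟨_, hn.1.2, rfl⟩

end Exploration

theorem exists_frequently_eq (α : Type*) [Countable α] [Nonempty α] :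
    ∃ r : ℕ → α, ∀ a, ∃ᶠ n in atTop, r n = a := by
  obtain ⟨g, hg⟩ := exists_surjective_nat α
  refine ⟨fun n => g n.unpair.1, fun a => ?_⟩
  obtain ⟨m, rfl⟩ := hg a
  refine frequently_atTop.2 fun n => ⟨Nat.pair m n, Nat.right_le_pair m n, by simp⟩

variable {V Ω : Type*} [MeasurableSpace V] [MeasurableSpace Ω] {M : FrogModel V Ω}
  [Countable V] [MeasurableSingletonClass V]
  {P : Measure Ω} [IsProbabilityMeasure P]

/-- If `x` is recurrent and `z` can be reached from `x`, then almost surely infinitely many of the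
sites visited from `x` have a frog visiting `z`. -/
theorem EL.ae_infinite_visits (hEL : M.EL P) :
    ∀ᵐ ω ∂P, ∀ x z, RelRecurrent (M.config ω).Visits x → M.CanReach ω x z →
      {y | ReflTransGen (M.config ω).Visits x y ∧ (M.config ω).Visits y z}.Infinite := by
  rcases isEmpty_or_nonempty V with hV | hV
  · exact Eventually.of_forall fun ω x => (hV.false x).elim
  obtain ⟨r, hr⟩ := exists_frequently_eq (V × ℕ+)
  have key : ∀ (x z : V) (k : ℕ), ∀ᵐ ω ∂P,
      ReachWithin (fun a b => (M.κ a b ω : ℝ)) {z} (1 / ((k : ℝ) + 1)) k x →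
      {n | ω ∈ M.examines x r n ∩ M.hitEvent (r n) x}.Infinite →
      {n | ω ∈ M.examines x r n ∩ M.hitEvent (r n) z}.Infinite := by
    intro x z k
    set δ : ℝ := 1 / ((k : ℝ) + 1) with hδ
    have h0 : 0 < δ := by positivity
    have h1 : δ ≤ 1 := by
      rw [hδ, div_le_one (by positivity)]
      linarith [Nat.cast_nonneg (α := ℝ) k]
    set C : Set Ω := {ω | ReachWithin (fun a b => (M.κ a b ω : ℝ)) {z} δ k x} with hC
    let ℱ : Filtration ℕ ‹MeasurableSpace Ω› :=
      ⟨M.exploreSigma x r, M.exploreSigma_mono, M.exploreSigma_le⟩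
    have hCm : ∀ n, MeasurableSet[ℱ n] C := by
      intro n
      exact @measurableSet_reachWithin V Ω _ (ℱ n) _ (fun _ => {z})
        (fun a b => measurable_subtype_coe.comp (M.measurable_κ_exploreSigma n a b))
        (fun a => @MeasurableSet.const _ (ℱ n) _) δ k x
    -- The outcome of step n is known only to the σ-field of index n + 1, hence the shift by one and
    -- the empty event at index 0.
    let s : V → ℕ → Set Ω := fun w n =>
      n.casesOn ∅ fun n => C ∩ (M.examines x r n ∩ M.hitEvent (r n) w)
    have hs : ∀ w n, MeasurableSet[ℱ n] (s w n) := by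
      intro w n
      cases n with
      | zero => exact @MeasurableSet.empty _ (ℱ 0)
      | succ n => exact (hCm (n + 1)).inter (M.measurableSet_examines_inter_hitEvent n w)
    have hmem : ∀ w, ∀ ω ∈ C, (ω ∈ limsup (s w) atTop ↔
        {n | ω ∈ M.examines x r n ∩ M.hitEvent (r n) w}.Infinite) := by
      intro w ω hω
      have hshift : (∃ᶠ n in atTop, ω ∈ s w n) ↔ ∃ᶠ n in atTop, ω ∈ s w (n + 1) := by
        conv_lhs => rw [← map_add_atTop_eq_nat 1]
        exact frequently_map
      rw [mem_limsup_iff_frequently_mem, ← Nat.frequently_atTop_iff_infinite, hshift]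
      exact frequently_congr (Eventually.of_forall fun n => ⟨fun h => h.2, fun h => ⟨hω, h⟩⟩)
    have hcmp : ∀ n, ∀ᵐ ω ∂P, δ ^ k * (P[(s x (n + 1)).indicator (1 : Ω → ℝ) | ℱ n]) ω ≤
        (P[(s z (n + 1)).indicator (1 : Ω → ℝ) | ℱ n]) ω := by
      intro n
      refine const_mul_condExp_indicator_le (ℱ.le n) (ℱ.le _ _ (hs x (n + 1)))
        (ℱ.le _ _ (hs z (n + 1))) fun B hB => ?_
      -- A frog about to be examined is unexamined, so on this event the past carries no information
      -- on its path beyond `F_0` of that frog, and ellipticity applies.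
      have hA : MeasurableSet[M.sigmaField 0 (r n).1 (r n).2] (B ∩ C ∩ M.examines x r n) := by
        have := (M.measurableSet_exploreSigma_diff_examined n (r n)).2 _
          ((hB.inter (hCm n)).inter (M.measurableSet_examines n))
        rwa [Set.inter_eq_left.2] at this
        exact fun ω hω => hω.2.2
      have := hEL.measure_inter_hits_le (r n).2.2 h0.le h1 (k := k) hA fun ω hω => hω.1.2
      have := ENNReal.toReal_mono (measure_ne_top _ _) this
      rw [ENNReal.toReal_mul, ENNReal.toReal_ofReal (by positivity)] at this
      rw [Set.inter_assoc, Set.inter_assoc, Set.inter_assoc, Set.inter_assoc] at this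
      exact this
    -- Conditional Borel–Cantelli: infinitely many successes occur exactly when the conditional
    -- probabilities sum to infinity. Divergence for x forces divergence for z.
    filter_upwards [ae_mem_limsup_atTop_iff P (hs x), ae_mem_limsup_atTop_iff P (hs z),
      ae_all_iff.2 hcmp] with ω hx hz hle hω hinf
    rw [← hmem z ω hω, hz]
    rw [← hmem x ω hω, hx] at hinf
    refine tendsto_atTop_mono (fun n => ?_) (hinf.const_mul_atTop (pow_pos h0 k))
    rw [Finset.mul_sum]
    exact Finset.sum_le_sum fun i _ => hle i
  filter_upwards [ae_all_iff.2 fun x => ae_all_iff.2 fun z => ae_all_iff.2 (key x z)]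
    with ω hω x z hx hxz
  obtain ⟨k, hk⟩ := exists_reachWithin_of_reflTransGen hxz (Set.mem_singleton z)
  rw [infinite_visits_iff hr]
  exact hω x z k hk ((infinite_visits_iff hr x).1 hx)

end FrogModel

/-! ### Visits by stopped frogs and measurability of closeness -/

/-- Some frog from `y` visits `x`, where `n` gives the number of frogs, `s` their paths and `τ` the
times at which they are stopped. -/
def FrogVisits {V : Type*} (n : V → ℕ) (τ : V → ℕ+ → ℕ∞) (s : ℕ → V → ℕ+ → V) (y x : V) : Prop :=
  ∃ i : ℕ+, (i : ℕ) ≤ n y ∧ ∃ j : ℕ, (j : ℕ∞) ≤ τ y i ∧ s j y i = x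

theorem FrogVisits.unstopped {V : Type*} {n : V → ℕ} {τ : V → ℕ+ → ℕ∞} {s : ℕ → V → ℕ+ → V}
    {y x : V} (h : FrogVisits n τ s y x) : FrogVisits n (fun _ _ => ⊤) s y x := by
  obtain ⟨i, hi, j, -, hj⟩ := h
  exact ⟨i, hi, j, le_top, hj⟩

theorem FrogConfig.visits_eq {V : Type*} (c : FrogConfig V) :
    c.Visits = FrogVisits c.num (fun _ _ => ⊤) c.pos := by
  funext y x
  simp [Visits, FrogVisits]

section Measurability

theorem measurableSet_cluster_infinite {V α : Type*} [Countable V] [MeasurableSpace α]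
    {c : α → V → V → ℝ}
    (hc : ∀ x y, Measurable fun a => c a x y) (v : V) :
    MeasurableSet {a | {y | ReflTransGen (fun x y => 0 < c a x y) v y ∧
      ReflTransGen (fun x y => 0 < c a x y) y v}.Infinite} :=
  measurableSet_infinite fun y =>
    (measurableSet_reflTransGen (fun x y => measurableSet_lt measurable_const (hc x y)) v y).inter
    (measurableSet_reflTransGen (fun x y => measurableSet_lt measurable_const (hc x y)) y v)

variable {V α : Type*} [MeasurableSpace V] [MeasurableSingletonClass V] [MeasurableSpace α]

theorem measurableSet_frogVisits {n : α → V → ℕ} {τ : α → V → ℕ+ → ℕ∞} {s : α → ℕ → V → ℕ+ → V}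
    (hn : ∀ x, Measurable fun a => n a x) (hτ : ∀ x i, Measurable fun a => τ a x i)
    (hs : ∀ j x i, Measurable fun a => s a j x i) (y x : V) :
    MeasurableSet {a | FrogVisits (n a) (τ a) (s a) y x} := by
  have : {a | FrogVisits (n a) (τ a) (s a) y x} = ⋃ i : ℕ+, (fun a => n a y) ⁻¹' Set.Ici (i : ℕ) ∩
      ⋃ j : ℕ, (fun a => τ a y i) ⁻¹' Set.Ici (j : ℕ∞) ∩ (fun a => s a j y i) ⁻¹' {x} := by
    ext a
    simp [FrogVisits]
  rw [this]
  exact MeasurableSet.iUnion fun i => (hn y measurableSet_Ici).inter (MeasurableSet.iUnion fun j =>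
    (hτ y i (MeasurableSet.of_discrete)).inter (hs j y i (measurableSet_singleton x)))

variable [Countable V]

/-- The path `p` is infinitely often close to `D`. -/
def OftenClose (c : V → V → ℝ) (D : Set V) (p : ℕ → V) : Prop :=
  ∃ m : ℕ, ∃ᶠ j in atTop, ReachWithin c D (1 / ((m : ℝ) + 1)) m (p j)

theorem measurableSet_reachWithin_path {c : α → V → V → ℝ} {D : α → Set V} {q : α → V}
    (hc : ∀ x y, Measurable fun a => c a x y) (hD : ∀ x, MeasurableSet {a | x ∈ D a})
    (hq : Measurable q) (δ : ℝ) (k : ℕ) :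
    MeasurableSet {a | ReachWithin (c a) (D a) δ k (q a)} := by
  have : {a | ReachWithin (c a) (D a) δ k (q a)} =
      ⋃ x, q ⁻¹' {x} ∩ {a | ReachWithin (c a) (D a) δ k x} := by
    ext a
    simp
  rw [this]
  exact MeasurableSet.iUnion fun x => (hq (measurableSet_singleton x)).inter
    (measurableSet_reachWithin hc hD δ k x)

theorem measurableSet_oftenClose {c : α → V → V → ℝ} {D : α → Set V} {p : α → ℕ → V}
    (hc : ∀ x y, Measurable fun a => c a x y) (hD : ∀ x, MeasurableSet {a | x ∈ D a})
    (hp : ∀ j, Measurable fun a => p a j) :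
    MeasurableSet {a | OftenClose (c a) (D a) (p a)} := by
  have : {a | OftenClose (c a) (D a) (p a)} = ⋃ m : ℕ, ⋂ n : ℕ, ⋃ j : ℕ, ⋃ _ : n ≤ j,
      {a | ReachWithin (c a) (D a) (1 / ((m : ℝ) + 1)) m (p a j)} := by
    ext a
    simp [OftenClose, frequently_atTop]
  rw [this]
  exact MeasurableSet.iUnion fun m => MeasurableSet.iInter fun n => MeasurableSet.iUnion fun j =>
    MeasurableSet.iUnion fun _ => measurableSet_reachWithin_path hc hD (hp j) _ m

theorem IsEllipticPath.ae_hits_of_oftenClose {c : V → V → ℝ} {μ : Measure (ℕ → V)}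
    [IsProbabilityMeasure μ] (h : IsEllipticPath c μ) (D : Set V) :
    ∀ᵐ p ∂μ, OftenClose c D p → p ∈ pathHits D := by
  have : ∀ m : ℕ, ∀ᵐ p ∂μ, (∃ᶠ j in atTop, ReachWithin c D (1 / ((m : ℝ) + 1)) m (p j)) →
      p ∈ pathHits D := fun m => by
    refine h.ae_hits (by positivity) ?_ m
    rw [div_le_one (by positivity)]
    linarith [Nat.cast_nonneg (α := ℝ) m]
  filter_upwards [ae_all_iff.2 this] with p hp ⟨m, hm⟩
  exact hp m hm

end Measurability

/-- The probability of infinitely many of the events `E j` is at least a common lower bound of their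
probabilities. -/
theorem le_measure_frequently {Ω : Type*} [MeasurableSpace Ω] {P : Measure Ω} [IsFiniteMeasure P]
    {E : ℕ → Set Ω} (hE : ∀ j, MeasurableSet (E j)) {c : ENNReal} (hc : ∀ j, c ≤ P (E j)) :
    c ≤ P {ω | ∃ᶠ j in atTop, ω ∈ E j} := by
  have : {ω | ∃ᶠ j in atTop, ω ∈ E j} = ⋂ n : ℕ, ⋃ j : ℕ, ⋃ _ : n ≤ j, E j := by
    ext ω
    simp [frequently_atTop]
  -- Continuity from above: the tail unions decrease, and each contains some `E n`.
  rw [this, Antitone.measure_iInter]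
  · exact le_iInf fun n => (hc n).trans
      (measure_mono (Set.subset_biUnion_of_mem (u := E) (show n ∈ {j | n ≤ j} from le_refl n)))
  · intro m n hmn
    exact Set.iUnion_mono fun j => Set.iUnion_mono' fun h => ⟨hmn.trans h, le_rfl⟩
  · exact fun n => (MeasurableSet.iUnion fun j =>
      MeasurableSet.iUnion fun _ => hE j).nullMeasurableSet
  · exact ⟨0, measure_ne_top _ _⟩

/-! ### Almost sure consequences of ellipticity, uniqueness and ergodicity -/

namespace FrogModel

variable {V Ω : Type*} [MeasurableSpace V] [mΩ : MeasurableSpace Ω] {M : FrogModel V Ω}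

theorem visits_stoppedConfig (ω : Ω) : (M.stoppedConfig ω).Visits =
    FrogVisits (fun x => M.η x ω) (fun x i => M.T x i ω) (fun j x i => M.S j x i ω) := by
  funext y x
  refine propext (exists_congr fun i => and_congr Iff.rfl ⟨?_, ?_⟩)
  · rintro ⟨j, hj⟩
    refine ⟨(min (j : ℕ∞) (M.T y i ω)).toNat, ?_, hj⟩
    rw [ENat.natCast_toNat (ne_top_of_le_ne_top (ENat.natCast_ne_top j) (min_le_left _ _))]
    exact min_le_right _ _
  · rintro ⟨j, hj, hx⟩
    refine ⟨j, ?_⟩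
    change M.S (min (j : ℕ∞) (M.T y i ω)).toNat y i ω = x
    rwa [min_eq_left hj, ENat.toNat_natCast]

theorem Rbar_subset_R (v : V) : M.Rbar v ⊆ M.R v := by
  intro ω h
  have h' := (FrogConfig.recurrent_iff _ _).1 h
  refine (FrogConfig.recurrent_iff _ _).2 (h'.mono fun x y hxy => ?_)
  rw [visits_stoppedConfig] at hxy
  rw [FrogConfig.visits_eq]
  exact hxy.unstopped

/-- Almost surely all steps of the frogs have positive ellipticity variables. -/
theorem EL.ae_step_pos [Countable V] [MeasurableSingletonClass V] {P : Measure Ω}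
    [IsProbabilityMeasure P] (hEL : M.EL P) :
    ∀ᵐ ω ∂P, ∀ (v : V) (i : ℕ+) (j : ℕ),
      (0 : ℝ) < M.κ (M.S j v i ω) (M.S (j + 1) v i ω) ω := by
  simp only [ae_all_iff]
  intro v i j
  have key : ∀ a y, ∀ᵐ ω ∂P, M.S j v i ω = a → M.S (j + 1) v i ω = y → (0 : ℝ) < M.κ a y ω := by
    intro a y
    have hm := M.sigmaField_le j v i
    set A : Set Ω := M.S j v i ⁻¹' {a} ∩ {ω | (M.κ a y ω : ℝ) ≤ 0} with hA
    set N : Set Ω := {ω' | M.S (j + 1) v i ω' = y} with hN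
    have hNm : MeasurableSet N := M.measurable_S _ _ _ (measurableSet_singleton y)
    have hAm : MeasurableSet[M.sigmaField j v i] A :=
      (M.measurable_S_sigmaField_self le_rfl v i (measurableSet_singleton a)).inter
        ((measurable_subtype_coe.comp (M.measurable_κ_sigmaField j v i a y)) measurableSet_Iic)
    have hint : Integrable (N.indicator fun _ => (1 : ℝ)) P := (integrable_const _).indicator hNm
    -- On A the upper bound in (EL) is 0; integrate it over A.
    have hreal : P.real (A ∩ N) ≤ 0 := by
      have h1 := setIntegral_condExp hm hint hAm
      rw [setIntegral_indicator hNm, setIntegral_const, smul_eq_mul, mul_one] at h1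
      change P.real (A ∩ N) ≤ 0
      rw [← h1]
      refine setIntegral_nonpos_of_ae_restrict ?_
      rw [EventuallyLE, ae_restrict_iff' (hm _ hAm)]
      filter_upwards [hEL v y i i.2 j] with ω hω hωA
      have ha : M.S j v i ω = a := hωA.1
      have h2 := hω.2
      rwa [ha, if_neg (not_lt.2 hωA.2)] at h2
    have hzero : P (A ∩ N) = 0 :=
      (measureReal_eq_zero_iff).1 (le_antisymm hreal measureReal_nonneg)
    filter_upwards [measure_eq_zero_iff_ae_notMem.1 hzero] with ω hω ha hy
    by_contra hpos
    exact hω ⟨⟨ha, not_lt.1 hpos⟩, hy⟩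
  filter_upwards [ae_all_iff.2 fun a => ae_all_iff.2 (key a)] with ω hω
  exact hω _ _ rfl rfl

theorem canReach_of_visits {ω : Ω} (hω : ∀ (v : V) (i : ℕ+) (j : ℕ),
      (0 : ℝ) < M.κ (M.S j v i ω) (M.S (j + 1) v i ω) ω) {x y : V}
    (h : ReflTransGen (M.config ω).Visits x y) : M.CanReach ω x y := by
  induction h with
  | refl => exact .refl
  | @tail y z _ hyz ih =>
    obtain ⟨i, -, j, rfl⟩ := hyz
    refine ih.trans ?_
    change M.CanReach ω y (M.S j y i ω)
    induction j with
    | zero =>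
      rw [M.S_zero]
      exact .refl
    | succ j ih' => exact ih'.tail (hω y i j)

theorem cluster_infinite_of_recurrent {ω : Ω} (hω : ∀ (v : V) (i : ℕ+) (j : ℕ),
      (0 : ℝ) < M.κ (M.S j v i ω) (M.S (j + 1) v i ω) ω) {v : V}
    (h : RelRecurrent (M.config ω).Visits v) : (M.cluster ω v).Infinite :=
  Set.Infinite.mono (fun _ hx => ⟨canReach_of_visits hω hx.1,
    canReach_of_visits hω (.single hx.2)⟩) h

/-- Some site other than v is reached from v, and the first link of the chain is a frog starting at
v. -/
theorem one_le_η_of_recurrent {ω : Ω} {v : V} (h : RelRecurrent (M.config ω).Visits v) :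
    1 ≤ M.η v ω := by
  obtain ⟨x, hx, hxv⟩ := h.exists_notMem_finset {v}
  rcases hx.1.cases_head with rfl | ⟨y, ⟨i, hi, -⟩, -⟩
  · simp at hxv
  · exact (show 1 ≤ (i : ℕ) from i.2).trans hi

/-- Almost surely, a site in an infinite cluster is recurrent if a recurrent site is visited
from it. -/
theorem ae_recurrent_of_visits_recurrent [Countable V] [MeasurableSingletonClass V] {P : Measure Ω}
    [IsProbabilityMeasure P] (hEL : M.EL P) (hUC : M.UC P) :
    ∀ᵐ ω ∂P, ∀ v x, (M.cluster ω v).Infinite → RelRecurrent (M.config ω).Visits x →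
      ReflTransGen (M.config ω).Visits v x → RelRecurrent (M.config ω).Visits v := by
  filter_upwards [hEL.ae_step_pos, hEL.ae_infinite_visits, hUC] with ω hpos hinf huc v x hv hx hvx
  -- The cluster of the recurrent x is infinite, so uniqueness puts v in it. Infinitely many sites
  -- woken from x then send a frog to v, and v wakes all of them through x.
  have hcl : M.cluster ω x = M.cluster ω v :=
    huc x v (cluster_infinite_of_recurrent hpos hx) hv
  have hxv : M.CanReach ω x v := by
    have : v ∈ M.cluster ω x := hcl ▸ ⟨.refl, .refl⟩
    exact this.1
  exact (hinf x v hx hxv).mono fun y hy => ⟨hvx.trans hy.1, hy.2⟩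

section Measurable

variable [Countable V] [MeasurableSingletonClass V]

theorem measurableSet_recurrent (v : V) : MeasurableSet {c : FrogConfig V | c.Recurrent v} := by
  simp only [FrogConfig.recurrent_iff, FrogConfig.visits_eq]
  refine measurableSet_relRecurrent (measurableSet_frogVisits (fun x => ?_)
    (fun _ _ => measurable_const) fun j x i => ?_) v
  · exact (measurable_pi_apply x).comp (measurable_fst.comp measurable_subtype_coe)
  · exact (measurable_pi_apply i).comp ((measurable_pi_apply x).comp ((measurable_pi_apply j).comp
      (measurable_snd.comp measurable_subtype_coe)))

/-- `R̄_v` is measurable with respect to the data of the model. -/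
theorem measurableSet_mem_Rbar {α : Type*} [MeasurableSpace α] {g : α → Ω}
    (hη : ∀ x, Measurable fun a => M.η x (g a)) (hT : ∀ x i, Measurable fun a => M.T x i (g a))
    (hS : ∀ j x (i : ℕ+), Measurable fun a => M.S j x i (g a)) (v : V) :
    MeasurableSet {a | g a ∈ M.Rbar v} := by
  have : {a | g a ∈ M.Rbar v} = {a | RelRecurrent (FrogVisits (fun x => M.η x (g a))
      (fun x i => M.T x i (g a)) (fun j x i => M.S j x i (g a))) v} := by
    ext a
    change (M.stoppedConfig (g a)).Recurrent v ↔ _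
    rw [FrogConfig.recurrent_iff, visits_stoppedConfig]
    rfl
  rw [this]
  exact measurableSet_relRecurrent (measurableSet_frogVisits hη hT hS) v

theorem measurableSet_Rbar (v : V) : MeasurableSet (M.Rbar v) :=
  measurableSet_mem_Rbar (g := id) M.measurable_η M.measurable_T
    (fun j x i => M.measurable_S j x i) v

/-- If some site can be recurrent for the stopped frogs, then almost surely there is such a site. -/
theorem ae_exists_Rbar {P : Measure Ω} (hERG : M.ERG P) {v : V} (hv : 0 < P (M.Rbar v))
    [IsProbabilityMeasure P] : ∀ᵐ ω ∂P, ∃ x, ω ∈ M.Rbar x := by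
  have hm : MeasurableSet (⋃ x, M.Rbar x) := MeasurableSet.iUnion fun x => measurableSet_Rbar x
  -- A permutation only relabels the recurrent sites, so their existence is exactly invariant.
  have hinv : M.AlmostInvariant P (⋃ x, M.Rbar x) := by
    refine ⟨hm, ⋃ x, {c | c.Recurrent x},
      MeasurableSet.iUnion fun x => measurableSet_recurrent x, fun φ => ?_⟩
    refine Eventually.of_forall fun ω => propext ?_
    change ω ∈ (⋃ x, M.Rbar x) ↔
      (M.stoppedConfig ω).perm φ ∈ ⋃ x, {c : FrogConfig V | c.Recurrent x}
    simp only [Set.mem_iUnion, Set.mem_ofPred_eq, FrogConfig.recurrent_perm]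
    exact (φ.exists_congr_right (q := fun x => ω ∈ M.Rbar x)).symm
  have hpos : P (⋃ x, M.Rbar x) ≠ 0 :=
    (hv.trans_le (measure_mono (Set.subset_iUnion _ v))).ne'
  have h1 : P (⋃ x, M.Rbar x) = 1 := (hERG _ hinv).resolve_left hpos
  filter_upwards [(mem_ae_iff_prob_eq_one hm).2 h1] with ω hω
  exact Set.mem_iUnion.1 hω

end Measurable

end FrogModel

/-! ### Replacing the path of the first frog -/

namespace FrogModel

variable {V Ω : Type*} [MeasurableSpace V] [mΩ : MeasurableSpace Ω] (M : FrogModel V Ω)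

open Classical in
/-- The frog paths, in which the path of the first frog from `v` is replaced by `p`. -/
noncomputable def substPath (v : V) (p : ℕ → V) (ω : Ω) (j : ℕ) (y : V) (i : ℕ+) : V :=
  if y = v ∧ i = 1 then p j else M.S j y i ω

/-- Some frog from `y` visits `x`, if the path of the first frog from `v` is replaced by `p`. -/
def SubstVisits (v : V) (p : ℕ → V) (ω : Ω) : V → V → Prop :=
  FrogVisits (fun x => M.η x ω) (fun _ _ => ⊤) (M.substPath v p ω)

/-- Some stopped frog from `y` visits `x`, if the path of the first frog from `v` is replaced
by `p`. -/
def SubstVisitsStopped (v : V) (p : ℕ → V) (ω : Ω) : V → V → Prop :=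
  FrogVisits (fun x => M.η x ω) (fun x i => M.T x i ω) (M.substPath v p ω)

variable {M}

theorem substPath_path (v : V) (ω : Ω) :
    M.substPath v (M.path v 1 ω) ω = fun j y (i : ℕ+) => M.S j y i ω := by
  funext j y i
  unfold substPath
  split_ifs with h
  · rw [h.1, h.2]
    rfl
  · rfl

theorem substVisits_path (v : V) (ω : Ω) :
    M.SubstVisits v (M.path v 1 ω) ω = (M.config ω).Visits := by
  rw [SubstVisits, substPath_path, FrogConfig.visits_eq]
  rfl

theorem substVisitsStopped_path (v : V) (ω : Ω) :
    M.SubstVisitsStopped v (M.path v 1 ω) ω = (M.stoppedConfig ω).Visits := by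
  rw [SubstVisitsStopped, substPath_path, visits_stoppedConfig]

theorem substVisits_of_ne {v y : V} (h : y ≠ v) (p q : ℕ → V) (ω : Ω) (z : V)
    (hp : M.SubstVisits v p ω y z) : M.SubstVisits v q ω y z := by
  obtain ⟨i, hi, j, hj, hz⟩ := hp
  refine ⟨i, hi, j, hj, ?_⟩
  rw [substPath, if_neg fun h' => h h'.1] at hz ⊢
  exact hz

theorem substVisits_self {v x : V} {p : ℕ → V} {ω : Ω} (hη : 1 ≤ M.η v ω)
    (hp : p ∈ pathHits {x}) : M.SubstVisits v p ω v x := by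
  obtain ⟨j, hj⟩ := hp
  refine ⟨1, hη, j, le_top, ?_⟩
  rw [substPath, if_pos ⟨rfl, rfl⟩]
  exact hj

/-- If `p` visits a site which is recurrent when the first frog from `v` has the path `q`, then `v`
is recurrent when this frog has one of these paths. -/
theorem recurrent_or_recurrent {v x : V} {p q : ℕ → V} {ω : Ω} (hη : 1 ≤ M.η v ω)
    (hp : ∀ x, RelRecurrent (M.SubstVisits v p ω) x →
      ReflTransGen (M.SubstVisits v p ω) v x → RelRecurrent (M.SubstVisits v p ω) v)
    (hq : ∀ x, RelRecurrent (M.SubstVisits v q ω) x →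
      ReflTransGen (M.SubstVisits v q ω) v x → RelRecurrent (M.SubstVisits v q ω) v)
    (hx : RelRecurrent (M.SubstVisitsStopped v q ω) x) (hpx : p ∈ pathHits {x}) :
    RelRecurrent (M.SubstVisits v q ω) v ∨ RelRecurrent (M.SubstVisits v p ω) v := by
  have hx' : RelRecurrent (M.SubstVisits v q ω) x := hx.mono fun _ _ h => h.unstopped
  rcases hx'.change_at (Q' := M.SubstVisits v p ω)
    (fun y hy z => substVisits_of_ne hy q p ω z) with h | h
  · exact Or.inl (hq x hx' h)
  · exact Or.inr (hp x h (.single (substVisits_self hη hpx)))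

theorem measurableSet_cluster_infinite_self [Countable V] (v : V) :
    MeasurableSet {ω | (M.cluster ω v).Infinite} :=
  measurableSet_cluster_infinite
    (fun x y => measurable_subtype_coe.comp (M.measurable_κ x y)) v

theorem measurable_extraPath [Countable V] [MeasurableSingletonClass V] (v : V) (j : ℕ) :
    Measurable fun ω => M.S j (M.X v ω) 0 ω := by
  refine measurable_to_countable' fun a => ?_
  have : (fun ω => M.S j (M.X v ω) 0 ω) ⁻¹' {a} = ⋃ u, M.X v ⁻¹' {u} ∩ M.S j u 0 ⁻¹' {a} := by
    ext ω
    simp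
  rw [this]
  exact MeasurableSet.iUnion fun u => (M.measurable_X v (measurableSet_singleton u)).inter
    (M.measurable_S j u 0 (measurableSet_singleton a))

theorem measurableSet_infCluster [Countable V] [MeasurableSingletonClass V] (v : V) :
    MeasurableSet (M.infCluster v) := by
  have : M.infCluster v = ⋃ u, M.X v ⁻¹' {u} ∩ {ω | (M.cluster ω u).Infinite} := by
    ext ω
    simp [infCluster]
  rw [this]
  exact MeasurableSet.iUnion fun u => (M.measurable_X v (measurableSet_singleton u)).inter
    (measurableSet_cluster_infinite_self u)

/-- The sites that are recurrent for the stopped frogs. -/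
def recurrentSites (M : FrogModel V Ω) (ω : Ω) : Set V := {x | ω ∈ M.Rbar x}

/-- The random variables of the model other than the `X_v`. -/
def data (M : FrogModel V Ω) (ω : Ω) : (V → V → Set.Icc (0 : ℝ) 1) × (V → ℕ+ → ℕ∞) ×
    (V → ℕ) × (ℕ → V → ℕ → V) :=
  (fun x y => M.κ x y ω, fun x i => M.T x i ω, fun x => M.η x ω, fun j x i => M.S j x i ω)

/-- The `σ`-field generated by `κ`, `T`, `η` and `S⁰`. -/
abbrev dataSigma (M : FrogModel V Ω) : MeasurableSpace Ω :=
  MeasurableSpace.comap M.data inferInstance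

/-- An event determined by `κ`, `T`, `η` and `S⁰` that does not occur when `X_v = v` has
probability zero. -/
theorem XCond.ae_of_ae_imp [MeasurableSingletonClass V] {P : Measure Ω} (hX : M.XCond P)
    {v : V} {N : Ω → Prop}
    (hN : MeasurableSet[M.dataSigma] {ω | N ω})
    (h : ∀ᵐ ω ∂P, M.X v ω = v → N ω) : ∀ᵐ ω ∂P, N ω := by
  obtain ⟨B, hB, hBN⟩ := hN.compl
  -- By independence the null event `{X_v = v} ∩ Nᶜ` has probability `P(X_v = v) P(Nᶜ)`, and the
  -- first factor is positive.
  have hind := (hX v).1.measure_inter_preimage_eq_mul {v} B (measurableSet_singleton v) hB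
  have h0 : P (M.X v ⁻¹' {v} ∩ {ω | N ω}ᶜ) = 0 := by
    rw [measure_eq_zero_iff_ae_notMem]
    filter_upwards [h] with ω hω hω'
    exact hω'.2 (hω hω'.1)
  change P (M.X v ⁻¹' {v} ∩ M.data ⁻¹' B) = P (M.X v ⁻¹' {v}) * P (M.data ⁻¹' B) at hind
  rw [hBN, h0, eq_comm, mul_eq_zero] at hind
  exact ae_iff.2 (hind.resolve_left (hX v).2.ne')

section Measurable

variable {v : V}

/-- The sample space with the information of `F_0(v, 1)`. -/
abbrev EnvSpace (M : FrogModel V Ω) (v : V) : Type _ := WithSigma Ω (M.sigmaField 0 v 1)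

variable {α : Type*} [MeasurableSpace α] {g : α → M.EnvSpace v} {p : α → ℕ → V}

/-- The replaced path is the only non-extra one that `F_0(v, 1)` does not determine. All quantities
built from it are thus jointly measurable in the `F_0(v, 1)`-information and p. -/
theorem measurable_substPath (hg : Measurable g) (hp : Measurable p) (j : ℕ) (y : V) (i : ℕ+) :
    Measurable fun a => M.substPath v (p a) (g a) j y i := by
  unfold substPath
  by_cases h : y = v ∧ i = 1
  · simp only [if_pos h]
    exact (measurable_pi_apply j).comp hp
  · simp only [if_neg h]
    refine (M.measurable_S_sigmaField_of_ne 0 j i.2 ?_).comp hg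
    intro he
    rw [Prod.mk.injEq] at he
    exact h ⟨he.1, PNat.eq he.2⟩

theorem measurable_κ_env (hg : Measurable g) (x y : V) :
    Measurable fun a => (M.κ x y (g a) : ℝ) :=
  measurable_subtype_coe.comp ((M.measurable_κ_sigmaField 0 v 1 x y).comp hg)

theorem measurableSet_cluster_env [Countable V] (hg : Measurable g) (x : V) :
    MeasurableSet {a | (M.cluster (g a) x).Infinite} :=
  measurableSet_cluster_infinite (measurable_κ_env hg) x

variable [MeasurableSingletonClass V]

theorem measurableSet_substVisits (hg : Measurable g) (hp : Measurable p) (y x : V) :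
    MeasurableSet {a | M.SubstVisits v (p a) (g a) y x} :=
  measurableSet_frogVisits (fun x => (M.measurable_η_sigmaField 0 v 1 x).comp hg)
    (fun _ _ => measurable_const) (measurable_substPath hg hp) y x

theorem measurableSet_substVisitsStopped (hg : Measurable g) (hp : Measurable p) (y x : V) :
    MeasurableSet {a | M.SubstVisitsStopped v (p a) (g a) y x} :=
  measurableSet_frogVisits (fun x => (M.measurable_η_sigmaField 0 v 1 x).comp hg)
    (fun x i => (M.measurable_T_sigmaField 0 v 1 x i).comp hg) (measurable_substPath hg hp) y x

end Measurable

/-! ### Stationarity of the environment and exchange of the two frogs -/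

section Main

variable [Countable V] [MeasurableSingletonClass V] {P : Measure Ω}
  [IsProbabilityMeasure P]

/-- The extra frog starting from a site in an infinite cluster is infinitely often close to the
set of recurrent sites. -/
theorem ae_oftenClose (hEL : M.EL P) (hUC : M.UC P) (hX : M.XCond P) {o : V → V}
    {φ : V → Equiv.Perm V} (hφ : ∀ x, φ x (o x) = x) (hID : M.ID o φ P)
    (hrec : ∀ᵐ ω ∂P, ∃ x, ω ∈ M.Rbar x) (v : V) :
    ∀ᵐ ω ∂P, (M.cluster ω v).Infinite →
      OftenClose (fun x y => (M.κ x y ω : ℝ)) (M.recurrentSites ω) (M.path v 0 ω) := by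
  have hD : Measurable[M.dataSigma] M.data := comap_measurable M.data
  have hκD : ∀ x y, Measurable[M.dataSigma] fun ω => (M.κ x y ω : ℝ) := fun x y =>
    measurable_subtype_coe.comp ((measurable_pi_apply y).comp ((measurable_pi_apply x).comp
      (measurable_fst.comp hD)))
  have hTD : ∀ x i, Measurable[M.dataSigma] fun ω => M.T x i ω := fun x i =>
    (measurable_pi_apply i).comp ((measurable_pi_apply x).comp
      (measurable_fst.comp (measurable_snd.comp hD)))
  have hηD : ∀ x, Measurable[M.dataSigma] fun ω => M.η x ω := fun x =>
    (measurable_pi_apply x).comp (measurable_fst.comp (measurable_snd.comp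
      (measurable_snd.comp hD)))
  have hSD : ∀ j x i, Measurable[M.dataSigma] fun ω => M.S j x i ω := fun j x i =>
    (measurable_pi_apply i).comp ((measurable_pi_apply x).comp ((measurable_pi_apply j).comp
      (measurable_snd.comp (measurable_snd.comp (measurable_snd.comp hD)))))
  have hclD : MeasurableSet[M.dataSigma] {ω | (M.cluster ω v).Infinite} :=
    @measurableSet_cluster_infinite V Ω _ M.dataSigma _ hκD v
  have hrecD : ∀ x, MeasurableSet[M.dataSigma] {ω | x ∈ M.recurrentSites ω} := fun x =>
    @measurableSet_mem_Rbar V Ω _ _ M _ _ Ω M.dataSigma id hηD hTD (fun j x i => hSD j x i) x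
  have hocD : MeasurableSet[M.dataSigma] {ω | OftenClose (fun x y => (M.κ x y ω : ℝ))
      (M.recurrentSites ω) (M.path v 0 ω)} :=
    @measurableSet_oftenClose V Ω _ _ M.dataSigma _ _ _ _ hκD hrecD (fun j => hSD j v 0)
  by_cases hpos : P (M.infCluster v) = 0
  · have : ∀ᵐ ω ∂P, ¬ (M.cluster ω v).Infinite := by
      refine hX.ae_of_ae_imp (v := v) hclD.compl ?_
      filter_upwards [measure_eq_zero_iff_ae_notMem.1 hpos] with ω hω hXv hinf
      refine hω ?_
      change (M.cluster ω (M.X v ω)).Infinite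
      rwa [hXv]
    exact this.mono fun ω h h' => absurd h' h
  obtain ⟨Pv, hPv, hac, hac', hident⟩ := hID v (pos_iff_ne_zero.2 hpos)
  let E : ℕ → ℕ → Set Ω := fun m j => {ω | ReachWithin (fun x y => (M.κ x y ω : ℝ))
    (M.recurrentSites ω) (1 / ((m : ℝ) + 1)) m (M.S j (M.X v ω) 0 ω)}
  have hE : ∀ m j, MeasurableSet (E m j) := fun m j =>
    measurableSet_reachWithin_path (fun x y => measurable_subtype_coe.comp (M.measurable_κ x y))
      (fun x => measurableSet_Rbar x) (measurable_extraPath v j) _ _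
  have hEmono : Monotone fun m => E m 0 := by
    intro m n hmn ω hω
    refine ReachWithin.mono ?_ hmn hω
    apply one_div_le_one_div_of_le (by positivity)
    have : (m : ℝ) ≤ n := by exact_mod_cast hmn
    linarith
  have hEeq : ∀ m j, Pv (E m j) = Pv (E m 0) := by
    intro m j
    -- Closeness is a property of the environment seen from the frog's position x, started at `o x`,
    -- which `φ x` carries to x. One set `H` therefore serves all times j.
    let H : Set ((V → ℕ) × (V → V → Set.Icc (0 : ℝ) 1) × V) :=
      {z | ReachWithin (fun x y => (z.2.1 x y : ℝ)) {y | z.1 y = 1} (1 / ((m : ℝ) + 1)) m z.2.2}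
    have hH : MeasurableSet H := by
      refine measurableSet_reachWithin_path (α := (V → ℕ) × (V → V → Set.Icc (0 : ℝ) 1) × V)
        (c := fun z x y => (z.2.1 x y : ℝ)) (D := fun z => {y | z.1 y = 1}) (q := fun z => z.2.2)
        (fun x y => measurable_subtype_coe.comp ((measurable_pi_apply y).comp
          ((measurable_pi_apply x).comp (measurable_fst.comp measurable_snd)))) (fun y => ?_)
        (measurable_snd.comp measurable_snd) _ _
      exact (measurable_pi_apply y).comp measurable_fst (measurableSet_singleton 1)
    have hEH : ∀ j, E m j = (fun ω => M.env o φ (M.S j (M.X v ω) 0 ω) ω) ⁻¹' H := by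
      intro j
      ext ω
      set x := M.S j (M.X v ω) 0 ω with hx
      change ReachWithin _ _ _ _ _ ↔ ReachWithin (fun a b => (M.κ (φ x a) (φ x b) ω : ℝ))
        {y | (M.Rbar (φ x y)).indicator 1 ω = 1} _ _ (o x)
      have hset : {y | (M.Rbar (φ x y)).indicator (1 : Ω → ℕ) ω = 1} =
          φ x ⁻¹' M.recurrentSites ω := by
        ext y
        by_cases hy : ω ∈ M.Rbar (φ x y)
        · simp [recurrentSites, hy]
        · simp [recurrentSites, hy]
      rw [hset, ReachWithin.map_equiv (c := fun x y => (M.κ x y ω : ℝ)) (φ x), hφ x]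
    rw [hEH, hEH]
    exact (hident j 0).measure_preimage_eq hH
  have hE0 : ∀ᵐ ω ∂Pv, ∃ m, ω ∈ E m 0 := by
    refine hac.ae_le ?_
    rw [ProbabilityTheory.cond]
    refine Measure.ae_smul_measure ?_ _
    rw [ae_restrict_iff' (measurableSet_infCluster v)]
    -- A recurrent site has an infinite cluster, which by uniqueness is that of `X_v`; hence the
    -- frog is at finite distance from it at time 0.
    filter_upwards [hrec, hUC, hEL.ae_step_pos] with ω ⟨x, hx⟩ huc hpos hinf
    have hxinf : (M.cluster ω x).Infinite := cluster_infinite_of_recurrent hpos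
      ((FrogConfig.recurrent_iff _ _).1 (Rbar_subset_R x hx))
    have hcl : M.cluster ω (M.X v ω) = M.cluster ω x := huc _ _ hinf hxinf
    have hmem : x ∈ M.cluster ω (M.X v ω) := hcl ▸ ⟨.refl, .refl⟩
    obtain ⟨m, hm⟩ := exists_reachWithin_of_reflTransGen (D := M.recurrentSites ω) hmem.1 hx
    refine ⟨m, ?_⟩
    change ReachWithin _ _ _ _ (M.S 0 (M.X v ω) 0 ω)
    rwa [M.S_zero]
  have hfreq : ∀ᵐ ω ∂Pv, ∃ m, ∃ᶠ j in atTop, ω ∈ E m j := by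
    have hUm : MeasurableSet {ω | ∃ m, ∃ᶠ j in atTop, ω ∈ E m j} :=
      measurableSet_oftenClose (fun x y => measurable_subtype_coe.comp (M.measurable_κ x y))
        (fun x => measurableSet_Rbar x) (measurable_extraPath v)
    refine (mem_ae_iff_prob_eq_one hUm).2 (le_antisymm prob_le_one ?_)
    have h1 : Pv (⋃ m, E m 0) = 1 :=
      (mem_ae_iff_prob_eq_one (MeasurableSet.iUnion fun m => hE m 0)).1
        (hE0.mono fun ω h => Set.mem_iUnion.2 h)
    rw [← h1, hEmono.measure_iUnion]
    -- For fixed m, closeness occurs infinitely often with probability at least that of closeness at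
    -- time 0, which tends to 1 as m grows.
    refine iSup_le fun m => (le_measure_frequently (hE m) fun j => (hEeq m j).ge).trans ?_
    exact measure_mono fun ω hω => ⟨m, hω⟩
  have hcond : ∀ᵐ ω ∂P, ω ∈ M.infCluster v → ∃ m, ∃ᶠ j in atTop, ω ∈ E m j := by
    have : ∀ᵐ ω ∂P[|M.infCluster v], ∃ m, ∃ᶠ j in atTop, ω ∈ E m j := hac'.ae_le hfreq
    rw [ProbabilityTheory.cond, Measure.ae_ennreal_smul_measure_iff
      (ENNReal.inv_ne_zero.2 (measure_ne_top P _))] at this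
    exact (ae_restrict_iff' (measurableSet_infCluster v)).1 this
  have hset : {ω | (M.cluster ω v).Infinite → OftenClose (fun x y => (M.κ x y ω : ℝ))
      (M.recurrentSites ω) (M.path v 0 ω)} = {ω | (M.cluster ω v).Infinite}ᶜ ∪
      {ω | OftenClose (fun x y => (M.κ x y ω : ℝ)) (M.recurrentSites ω) (M.path v 0 ω)} := by
    ext ω
    exact imp_iff_not_or
  refine hX.ae_of_ae_imp (v := v) (hset ▸ hclD.compl.union hocD) ?_
  filter_upwards [hcond] with ω hω hXv hinf
  obtain ⟨m, hm⟩ := hω (by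
    change (M.cluster ω (M.X v ω)).Infinite
    rwa [hXv])
  refine ⟨m, hm.mono fun j hj => ?_⟩
  change ReachWithin _ _ _ _ (M.S j v 0 ω)
  change ReachWithin _ _ _ _ (M.S j (M.X v ω) 0 ω) at hj
  rwa [hXv] at hj

variable [Nonempty V]

theorem map_path_eq_compProd (v : V) :
    P.map (fun ω => (toSigma (M.sigmaField 0 v 1) ω, M.path v 1 ω)) =
      P.map (toSigma (M.sigmaField 0 v 1)) ⊗ₘ M.pathLaw P v 1 :=
  (compProd_map_condDistrib (M.measurable_path v 1).aemeasurable).symm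

theorem EX.map_paths_eq_compProd (hEX : M.EX P) (v : V) :
    P.map (fun ω => (toSigma (M.sigmaField 0 v 1) ω, M.path v 1 ω, M.path v 0 ω)) =
      P.map (toSigma (M.sigmaField 0 v 1)) ⊗ₘ (M.pathLaw P v 1 ×ₖ M.pathLaw P v 1) :=
  map_prod_eq_compProd_of_condIID (M.sigmaField_le 0 v 1) (M.measurable_path v 0)
    (M.measurable_path v 1) (hEX v).1 (hEX v).2

theorem ae_pathLaw_of_ae {v : V} {N : M.EnvSpace v → (ℕ → V) → Prop}
    (hN : MeasurableSet {a : M.EnvSpace v × (ℕ → V) | N a.1 a.2})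
    (h : ∀ᵐ ω ∂P, N (toSigma _ ω) (M.path v 1 ω)) :
    ∀ᵐ ω ∂P, ∀ᵐ q ∂M.pathLaw P v 1 (toSigma _ ω), N (toSigma _ ω) q := by
  have hX := measurable_toSigma (M.sigmaField_le 0 v 1)
  have := (ae_map_iff (hX.prodMk (M.measurable_path v 1)).aemeasurable hN).2 h
  rw [map_path_eq_compProd] at this
  exact ae_of_ae_map hX.aemeasurable (Measure.ae_ae_of_ae_compProd this)

theorem ae_of_ae_pathLaw {v : V} {N : M.EnvSpace v → (ℕ → V) → Prop}
    (hN : MeasurableSet {a : M.EnvSpace v × (ℕ → V) | N a.1 a.2})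
    (h : ∀ᵐ ω ∂P, ∀ᵐ q ∂M.pathLaw P v 1 (toSigma _ ω), N (toSigma _ ω) q) :
    ∀ᵐ ω ∂P, N (toSigma _ ω) (M.path v 1 ω) := by
  have hX := measurable_toSigma (M.sigmaField_le 0 v 1)
  refine ae_of_ae_map (hX.prodMk (M.measurable_path v 1)).aemeasurable
    (p := fun a : M.EnvSpace v × (ℕ → V) => N a.1 a.2) ?_
  rw [map_path_eq_compProd, ae_iff]
  have hNc : MeasurableSet {a : M.EnvSpace v × (ℕ → V) | ¬ N a.1 a.2} := hN.compl
  rw [Measure.compProd_apply hNc, lintegral_map (Kernel.measurable_kernel_prodMk_left hNc) hX]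
  exact lintegral_eq_zero_of_ae_eq_zero h

/-- Disintegration over `F_0(v, 1)` followed by Fubini for the product of the two equal conditional
laws. The extra frog becomes an independent copy of the first one. -/
theorem EX.ae_ae_pathLaw_of_ae (hEX : M.EX P) {v : V}
    {N : M.EnvSpace v → (ℕ → V) → (ℕ → V) → Prop}
    (hN : MeasurableSet {a : M.EnvSpace v × (ℕ → V) × (ℕ → V) | N a.1 a.2.1 a.2.2})
    (h : ∀ᵐ ω ∂P, N (toSigma _ ω) (M.path v 1 ω) (M.path v 0 ω)) :
    ∀ᵐ ω ∂P, ∀ᵐ q ∂M.pathLaw P v 1 (toSigma _ ω), ∀ᵐ p ∂M.pathLaw P v 1 (toSigma _ ω),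
      N (toSigma _ ω) q p := by
  have hX := measurable_toSigma (M.sigmaField_le 0 v 1)
  have := (ae_map_iff (hX.prodMk ((M.measurable_path v 1).prodMk
    (M.measurable_path v 0))).aemeasurable hN).2 h
  rw [hEX.map_paths_eq_compProd] at this
  filter_upwards [ae_of_ae_map hX.aemeasurable (Measure.ae_ae_of_ae_compProd this)] with ω hω
  rw [Kernel.prod_apply] at hω
  exact Measure.ae_ae_of_ae_prod hω

/-- If almost surely some site is recurrent for the stopped frogs, then almost surely every occupied
site in an infinite cluster is recurrent. -/
theorem ae_recurrent (hEL : M.EL P) (hUC : M.UC P) (hEX : M.EX P) (hX : M.XCond P) {o : V → V}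
    {φ : V → Equiv.Perm V} (hφ : ∀ x, φ x (o x) = x) (hID : M.ID o φ P)
    (hrec : ∀ᵐ ω ∂P, ∃ x, ω ∈ M.Rbar x) (v : V) :
    ∀ᵐ ω ∂P, 1 ≤ M.η v ω ∧ (M.cluster ω v).Infinite → ω ∈ M.R v := by
  have hgood := ae_pathLaw_of_ae (M := M) (P := P) (v := v)
    (N := fun ω q => (M.cluster ω v).Infinite → ∀ x, RelRecurrent (M.SubstVisits v q ω) x →
      ReflTransGen (M.SubstVisits v q ω) v x → RelRecurrent (M.SubstVisits v q ω) v) (by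
    have hQ := measurableSet_substVisits (M := M) (v := v)
      (α := M.EnvSpace v × (ℕ → V)) measurable_fst measurable_snd
    have hcl := measurableSet_cluster_env (M := M) (v := v)
      (α := M.EnvSpace v × (ℕ → V)) measurable_fst v
    rw [measurableSet_setOfPred] at hcl ⊢
    refine hcl.imp (Measurable.forall fun x => ?_)
    exact (measurableSet_setOfPred.1 (measurableSet_relRecurrent hQ x)).imp
      ((measurableSet_setOfPred.1 (measurableSet_reflTransGen hQ v x)).imp
        (measurableSet_setOfPred.1 (measurableSet_relRecurrent hQ v)))) (by
    filter_upwards [ae_recurrent_of_visits_recurrent hEL hUC] with ω hω hinf x hx hvx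
    change RelRecurrent (M.SubstVisits v (M.path v 1 ω) ω) x at hx
    change ReflTransGen (M.SubstVisits v (M.path v 1 ω) ω) v x at hvx
    change RelRecurrent (M.SubstVisits v (M.path v 1 ω) ω) v
    rw [substVisits_path] at hx hvx ⊢
    exact hω v x hinf hx hvx)
  -- The recurrent set is computed with q, while the path close to it is the independent p. So the
  -- target is fixed when ellipticity is applied to p.
  have hclose := hEX.ae_ae_pathLaw_of_ae (v := v)
    (N := fun ω q p => (M.cluster ω v).Infinite → OftenClose (fun x y => (M.κ x y ω : ℝ))
      {x | RelRecurrent (M.SubstVisitsStopped v q ω) x} p) (by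
    have hQ := measurableSet_substVisitsStopped (M := M) (v := v)
      (α := M.EnvSpace v × (ℕ → V) × (ℕ → V)) measurable_fst (measurable_fst.comp measurable_snd)
    have hcl := measurableSet_cluster_env (M := M) (v := v)
      (α := M.EnvSpace v × (ℕ → V) × (ℕ → V)) measurable_fst v
    have hoc := measurableSet_oftenClose (measurable_κ_env (M := M) (v := v)
      (α := M.EnvSpace v × (ℕ → V) × (ℕ → V)) measurable_fst)
      (fun x => measurableSet_relRecurrent hQ x)
      (fun j => (measurable_pi_apply j).comp (measurable_snd.comp measurable_snd))
    rw [measurableSet_setOfPred] at hcl hoc ⊢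
    exact hcl.imp hoc) (by
    filter_upwards [ae_oftenClose hEL hUC hX hφ hID hrec v] with ω hω hinf
    have hset : {x | RelRecurrent (M.SubstVisitsStopped v (M.path v 1 ω) ω) x} =
        M.recurrentSites ω := by
      ext x
      rw [substVisitsStopped_path]
      exact (FrogConfig.recurrent_iff _ _).symm
    change OftenClose _ {x | RelRecurrent (M.SubstVisitsStopped v (M.path v 1 ω) ω) x} _
    rw [hset]
    exact hω hinf)
  have hae := ae_of_ae_pathLaw (M := M) (P := P) (v := v)
    (N := fun ω q => 1 ≤ M.η v ω ∧ (M.cluster ω v).Infinite →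
      RelRecurrent (M.SubstVisits v q ω) v) (by
    have hQ := measurableSet_substVisits (M := M) (v := v)
      (α := M.EnvSpace v × (ℕ → V)) measurable_fst measurable_snd
    have hcl := measurableSet_cluster_env (M := M) (v := v)
      (α := M.EnvSpace v × (ℕ → V)) measurable_fst v
    have hη : MeasurableSet {a : M.EnvSpace v × (ℕ → V) | 1 ≤ M.η v a.1} :=
      (M.measurable_η_sigmaField 0 v 1 v).comp measurable_fst measurableSet_Ici
    exact measurableSet_setOfPred.2 ((measurableSet_setOfPred.1 (hη.inter hcl)).imp
      (measurableSet_setOfPred.1 (measurableSet_relRecurrent hQ v)))) (by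
    filter_upwards [hgood, hclose, hEL.ae_isEllipticPath v le_rfl] with ω h1 h2 h3
    by_cases hv : 1 ≤ M.η v ω ∧ (M.cluster ω v).Infinite
    swap
    · exact Eventually.of_forall fun q h => absurd h hv
    have key : ∀ᵐ q ∂M.pathLaw P v 1 (toSigma _ ω), ∀ᵐ p ∂M.pathLaw P v 1 (toSigma _ ω),
        RelRecurrent (M.SubstVisits v q ω) v ∨ RelRecurrent (M.SubstVisits v p ω) v := by
      filter_upwards [h1, h2] with q hq1 hq2
      filter_upwards [h1, hq2, h3.ae_hits_of_oftenClose
        {x | RelRecurrent (M.SubstVisitsStopped v q ω) x}] with p hp1 hp2 hp3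
      obtain ⟨j, hj⟩ := hp3 (hp2 hv.2)
      exact recurrent_or_recurrent hv.1 (hp1 hv.2) (hq1 hv.2) hj ⟨j, rfl⟩
    -- If v failed to be recurrent for a non-null set of q, one such q could be fixed for which
    -- almost every p makes v recurrent. As p has the law of q, the claim holds in this case too.
    by_cases hall : ∀ᵐ q ∂M.pathLaw P v 1 (toSigma _ ω), RelRecurrent (M.SubstVisits v q ω) v
    · exact hall.mono fun q hq _ => hq
    · obtain ⟨q, hq, hq'⟩ := (key.and_frequently (not_eventually.1 hall)).exists
      exact hq.mono fun p hp _ => hp.resolve_left hq')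
  filter_upwards [hae] with ω hω hv
  have := hω hv
  change RelRecurrent (M.SubstVisits v (M.path v 1 ω) ω) v at this
  rw [substVisits_path] at this
  exact (FrogConfig.recurrent_iff _ _).2 this

end Main

end FrogModel

/-! ### The zero-one law -/

theorem theorem2 {V Ω : Type*} [Countable V] [Infinite V]
    [MeasurableSpace V] [MeasurableSingletonClass V] [MeasurableSpace Ω]
    (P : Measure Ω) [IsProbabilityMeasure P] (M : FrogModel V Ω)
    (o : V → V) (ho : ∀ x, o (o x) = o x)
    (φ : V → Equiv.Perm V) (hφ : ∀ x, φ x (o x) = x)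
    (hEL : M.EL P) (hUC : M.UC P) (hT : M.StopCond P) (hERG : M.ERG P)
    (hEX : M.EX P) (hX : M.XCond P) (hID : M.ID o φ P) :
    (∀ v, P (M.R v) = 0) ∨
    (∀ v, P (M.R v) = P {ω | 1 ≤ M.η v ω ∧ (M.cluster ω v).Infinite}) := by
  by_cases h0 : ∀ v, P (M.R v) = 0
  · exact Or.inl h0
  push Not at h0
  obtain ⟨u, hu⟩ := h0
  have hrec := FrogModel.ae_exists_Rbar hERG (hT u (pos_iff_ne_zero.2 hu))
  refine Or.inr fun v => measure_congr ?_
  filter_upwards [FrogModel.ae_recurrent hEL hUC hEX hX hφ hID hrec v, hEL.ae_step_pos]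
    with ω hω hpos
  refine propext ⟨fun h => ?_, hω⟩
  have h' := (FrogConfig.recurrent_iff _ _).1 h
  exact ⟨FrogModel.one_le_η_of_recurrent h', FrogModel.cluster_infinite_of_recurrent hpos h'⟩
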